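/- Let $\Bbbk$ be a field of characteristic zero. Let $\Lambda'$ be the free associative $\Bbbk$-algebra on generators $h_1,h_2,\dots$ (with $h_0=1$), graded by $\deg h_n=n$, and let $\Delta:\Lambda'\to\Lambda'\otimes\Lambda'$ be the algebra homomorphism with $\Delta(h_n)=\sum_{m=0}^n h_m\otimes h_{n-m}$, where $\Lambda'\otimes\Lambda'$ has the multiplication $(x_1\otimes x_2)(y_1\otimes y_2)=(-1)^{\deg(x_2)\deg(y_1)}x_1y_1\otimes x_2y_2$ on homogeneous elements. For a finite sequence $\alpha=(a_1,\dots,a_r)$ of positive integers put $h_\alpha=h_{a_1}\cdots h_{a_r}$, $|\alpha|=a_1+\dots+a_r$ and $S_\alpha=S_{a_1}\times\dots\times S_{a_r}\subset S_{|\alpha|}$. Define a bilinear form on $\Lambda'$ by $(h_\beta,h_\alpha)=\sum_{c\in S_\beta\backslash S_n/S_\alpha}(-1)^{\ell(c)}$ if $|\alpha|=|\beta|=n$, where $\ell(c)$ is the minimal Coxeter length of an element of the double coset $c$, and $(h_\beta,h_\alpha)=0$ if $|\alpha|\ne|\beta|$. Let $\Lambda=\bigoplus_{n\ge 0}\Lambda_n$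 be the quotient of $\Lambda'$ by the radical of this form (the odd symmetric functions), with the induced form. Then $\Delta$ descends to a unique linear map $\Delta:\Lambda\to\Lambda\otimes\Lambda$, and there is a unique family of elements $m_\lambda\in\Lambda_{|\lambda|}$, indexed by the partitions $\lambda$, with $(h_\lambda,m_\mu)=\delta_{\lambda\mu}$ for all partitions $\lambda,\mu$ of the same integer (the odd monomial symmetric functions). Write $m_n=m_{(n)}$. The subspace of primitive elements $$P=\{x\in\Lambda:\Delta(x)=1\otimes x+x\otimes 1\}$$ is the span of $m_1$ and the elements $m_{2k}$, $k\ge 1$. Moreover, $P\cap\Lambda_n$ is one-dimensional if $n=1$ or if $n\geq 2$ is even, and is zero if $n=0$ or if $n\ge 3$ is odd. -/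

import Mathlib

open scoped TensorProduct

noncomputable section

namespace OddSymm

/-! ### The free graded algebra `Λ'` -/

/-- The free associative `R`-algebra `Λ'` on generators `h₁, h₂, …`. -/
abbrev FreeH (R : Type*) [CommRing R] : Type _ := FreeAlgebra R ℕ+

/-- The degree `a₁ + ⋯ + a_r` of the word `h_{a₁} ⋯ h_{a_r}`. -/
def weight (w : FreeMonoid ℕ+) : ℕ := (w.toList.map (fun a : ℕ+ => (a : ℕ))).sum

/-- The elements `h_n` of `Λ'`, with `h_0 = 1`. -/
def h (R : Type*) [CommRing R] (n : ℕ) : FreeH R :=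
  if hn : 0 < n then FreeAlgebra.ι R (⟨n, hn⟩ : ℕ+) else 1

/-- The basis of `Λ'` consisting of the words `h_α = h_{a₁} ⋯ h_{a_r}`, with `α` running over
all finite sequences of positive integers. -/
abbrev hBasis (R : Type*) [CommRing R] : Module.Basis (FreeMonoid ℕ+) R (FreeH R) :=
  FreeAlgebra.basisFreeMonoid R ℕ+

/-- The word `h_{a₁} ⋯ h_{a_r}` as an element of `Λ'`. -/
def hWord (R : Type*) [CommRing R] (w : FreeMonoid ℕ+) : FreeH R :=
  FreeMonoid.lift (FreeAlgebra.ι R) w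

/-- The degree `n` part `Λ'_n`, spanned by the words of degree `n`. -/
def grading (R : Type*) [CommRing R] (n : ℕ) : Submodule R (FreeH R) :=
  Submodule.span R {x | ∃ w : FreeMonoid ℕ+, weight w = n ∧ x = hWord R w}

theorem hBasis_apply (R : Type*) [CommRing R] (w : FreeMonoid ℕ+) :
    hBasis R w = hWord R w := by
  simp [hBasis, FreeAlgebra.basisFreeMonoid, hWord, FreeAlgebra.equivMonoidAlgebraFreeMonoid]

theorem weight_one : weight 1 = 0 := by simp [weight]

theorem weight_mul (u v : FreeMonoid ℕ+) : weight (u * v) = weight u + weight v := by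
  simp [weight]

theorem weight_of (a : ℕ+) : weight (FreeMonoid.of a) = a := by simp [weight]

theorem hWord_mem (R : Type*) [CommRing R] (w : FreeMonoid ℕ+) :
    hWord R w ∈ grading R (weight w) :=
  Submodule.subset_span ⟨w, rfl, rfl⟩

theorem ι_mem (R : Type*) [CommRing R] (a : ℕ+) :
    FreeAlgebra.ι R a ∈ grading R (a : ℕ) :=
  Submodule.subset_span ⟨FreeMonoid.of a, weight_of a, by simp [hWord]⟩

instance gradedMonoid (R : Type*) [CommRing R] : SetLike.GradedMonoid (grading R) where
  one_mem := Submodule.subset_span ⟨1, weight_one, by simp [hWord]⟩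
  mul_mem := by
    intro i j x y hx hy
    have hxy := Submodule.mul_mem_mul hx hy
    rw [grading, grading, Submodule.span_mul_span] at hxy
    refine Submodule.span_mono ?_ hxy
    rintro _ ⟨_, ⟨u, hu, rfl⟩, _, ⟨v, hv, rfl⟩, rfl⟩
    exact ⟨u * v, by rw [weight_mul, hu, hv], by simp [hWord]⟩

/-- The algebra map splitting an element into homogeneous parts. -/
def decomposeHom (R : Type*) [CommRing R] :
    FreeH R →ₐ[R] DirectSum ℕ (fun i => grading R i) :=
  FreeAlgebra.lift R (fun a : ℕ+ =>
    DirectSum.of (fun i => grading R i) (a : ℕ) ⟨FreeAlgebra.ι R a, ι_mem R a⟩)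

theorem decomposeHom_hWord (R : Type*) [CommRing R] (w : FreeMonoid ℕ+) :
    decomposeHom R (hWord R w) =
      DirectSum.of (fun i => grading R i) (weight w) ⟨hWord R w, hWord_mem R w⟩ := by
  have h0 : hWord R 1 = 1 := by simp [hWord]
  induction w using FreeMonoid.inductionOn' with
  | one =>
    refine Eq.trans (b := DirectSum.of (fun i => grading R i) 0 ⟨1, SetLike.GradedOne.one_mem⟩) ?_ ?_
    · rw [h0, map_one]
      rfl
    · refine DirectSum.of_eq_of_gradedMonoid_eq ?_
      exact Sigma.subtype_ext weight_one.symm h0.symm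
  | of_mul a w ih =>
    have h1 : hWord R (FreeMonoid.of a * w) = FreeAlgebra.ι R a * hWord R w := by
      simp [hWord]
    refine (congrArg (decomposeHom R) h1).trans ?_
    rw [map_mul, ih, decomposeHom, FreeAlgebra.lift_ι_apply, DirectSum.of_mul_of]
    refine DirectSum.of_eq_of_gradedMonoid_eq ?_
    have hwt : (a : ℕ) + weight w = weight (FreeMonoid.of a * w) := by
      rw [weight_mul, weight_of]
    exact Sigma.subtype_ext hwt h1.symm

/-- `Λ'` is a graded algebra with `deg h_n = n`. -/
instance gradedAlgebra (R : Type*) [CommRing R] : GradedAlgebra (grading R) :=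
  GradedAlgebra.ofAlgHom (grading R) (decomposeHom R)
    (by
      refine FreeAlgebra.hom_ext (funext fun a => ?_)
      simp [decomposeHom])
    (by
      rintro i ⟨x, hx⟩
      induction hx using Submodule.span_induction with
      | mem x hx =>
        obtain ⟨w, rfl, rfl⟩ := hx
        exact decomposeHom_hWord R w
      | zero =>
        rw [map_zero]
        exact (map_zero (DirectSum.of (fun i => grading R i) i)).symm
      | add x y hx hy ihx ihy =>
        rw [map_add, ihx, ihy, ← map_add]
        rfl
      | smul r x hx ih =>
        rw [map_smul, ih]
        exact (map_smul (DirectSum.lof R ℕ (fun i => grading R i) i) r ⟨x, hx⟩).symm)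

/-! ### The comultiplication of `Λ'` -/

/-- The comultiplication of `Λ'`: the algebra map with `Δ(h_n) = ∑_{m=0}^n h_m ⊗ h_{n-m}`, where
the tensor square carries the multiplication
`(x₁ ⊗ x₂)(y₁ ⊗ y₂) = (-1)^{deg x₂ deg y₁} x₁y₁ ⊗ x₂y₂`. -/
def freeComul (R : Type*) [CommRing R] :
    FreeH R →ₐ[R] GradedTensorProduct R (grading R) (grading R) :=
  FreeAlgebra.lift R (fun a : ℕ+ =>
    ∑ m ∈ Finset.range ((a : ℕ) + 1),
      GradedTensorProduct.of R (grading R) (grading R)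
        (h R m ⊗ₜ[R] h R ((a : ℕ) - m)))

/-- The comultiplication of `Λ'` as a linear map into the underlying module `Λ' ⊗ Λ'`. -/
def freeComulLin (R : Type*) [CommRing R] : FreeH R →ₗ[R] FreeH R ⊗[R] FreeH R :=
  (GradedTensorProduct.of R (grading R) (grading R)).symm.toLinearMap ∘ₗ
    (freeComul R).toLinearMap

/-! ### The bilinear form on `Λ'` -/

/-- A word of degree `n` as a composition of `n`. -/
def toComposition (n : ℕ) (w : FreeMonoid ℕ+) (hw : weight w = n) : Composition n where
  blocks := w.toList.map (fun a : ℕ+ => (a : ℕ))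
  blocks_pos := by
    intro i hi
    obtain ⟨a, -, rfl⟩ := List.mem_map.1 hi
    exact a.pos
  blocks_sum := hw

/-- The parabolic subgroup `S_{a₁} × ⋯ × S_{a_r} ⊆ S_n` of a composition `(a₁, …, a_r)` of `n`:
the permutations that preserve every block. -/
def parabolic {n : ℕ} (c : Composition n) : Subgroup (Equiv.Perm (Fin n)) where
  carrier := {σ | ∀ i, c.index (σ i) = c.index i}
  one_mem' := fun _ => rfl
  mul_mem' := by
    intro σ τ hσ hτ i
    rw [Equiv.Perm.mul_apply, hσ, hτ]
  inv_mem' := by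
    intro σ hσ i
    have H := hσ (σ⁻¹ i)
    rw [← Equiv.Perm.mul_apply, mul_inv_cancel, Equiv.Perm.one_apply] at H
    exact H.symm

/-- The Coxeter length of a permutation: the number of pairs `i < j` with `σ i > σ j`. -/
def permLength {n : ℕ} (σ : Equiv.Perm (Fin n)) : ℕ :=
  (Finset.univ.filter (fun p : Fin n × Fin n => p.1 < p.2 ∧ σ p.2 < σ p.1)).card

/-- The set of double cosets `S_β \ S_n / S_α`. -/
abbrev DCoset {n : ℕ} (β α : Composition n) : Type :=
  DoubleCoset.Quotient (parabolic β : Set (Equiv.Perm (Fin n))) (parabolic α)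

/-- The length `ℓ(c)` of a double coset: the minimal length of its elements. -/
def cosetLength {n : ℕ} {β α : Composition n} (c : DCoset β α) : ℕ :=
  sInf {l | ∃ σ : Equiv.Perm (Fin n),
    DoubleCoset.mk (parabolic β) (parabolic α) σ = c ∧ permLength σ = l}

/-- The signed count `∑_c (-1)^{ℓ(c)}` over all (finitely many) double cosets. -/
def signedCount (R : Type*) [CommRing R] {n : ℕ} (β α : Composition n) : R :=
  ∑ᶠ c : DCoset β α, (-1 : R) ^ cosetLength c

/-- The value of the bilinear form on two words. -/
def pairing (R : Type*) [CommRing R] (v w : FreeMonoid ℕ+) : R :=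
  if hvw : weight v = weight w then
    signedCount R (toComposition (weight w) v hvw) (toComposition (weight w) w rfl)
  else 0

/-- The bilinear form on `Λ'`, with `(h_β, h_α) = ∑_{c ∈ S_β \ S_n / S_α} (-1)^{ℓ(c)}` if
`|α| = |β| = n`, and `0` if `|α| ≠ |β|`. -/
def freeForm (R : Type*) [CommRing R] : LinearMap.BilinForm R (FreeH R) :=
  (hBasis R).constr R (fun v => (hBasis R).constr R (fun w => pairing R v w))

theorem freeForm_hWord (R : Type*) [CommRing R] (v w : FreeMonoid ℕ+) :
    freeForm R (hWord R v) (hWord R w) = pairing R v w := by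
  rw [freeForm, ← hBasis_apply, ← hBasis_apply, Module.Basis.constr_basis,
    Module.Basis.constr_basis]

theorem permLength_inv {n : ℕ} (σ : Equiv.Perm (Fin n)) : permLength σ⁻¹ = permLength σ := by
  refine Finset.card_bij' (fun p _ => (σ⁻¹ p.2, σ⁻¹ p.1)) (fun p _ => (σ p.2, σ p.1)) ?_ ?_ ?_ ?_
  all_goals simp +contextual

theorem mk_inv_eq_iff {n : ℕ} (β α : Composition n) (σ τ : Equiv.Perm (Fin n)) :
    DoubleCoset.mk (parabolic α) (parabolic β) σ⁻¹ = DoubleCoset.mk (parabolic α) (parabolic β) τ⁻¹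
      ↔ DoubleCoset.mk (parabolic β) (parabolic α) σ =
        DoubleCoset.mk (parabolic β) (parabolic α) τ := by
  have key : ∀ (γ δ : Composition n) (a b : Equiv.Perm (Fin n)),
      DoubleCoset.mk (parabolic γ) (parabolic δ) a = DoubleCoset.mk (parabolic γ) (parabolic δ) b →
      DoubleCoset.mk (parabolic δ) (parabolic γ) a⁻¹ =
        DoubleCoset.mk (parabolic δ) (parabolic γ) b⁻¹ := by
    intro γ δ a b hab
    rw [DoubleCoset.eq] at hab ⊢
    obtain ⟨p, hp, q, hq, rfl⟩ := hab
    exact ⟨q⁻¹, inv_mem hq, p⁻¹, inv_mem hp, by group⟩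
  refine ⟨fun H => ?_, key β α σ τ⟩
  simpa using key α β _ _ H

/-- Inversion as a bijection `S_β \ S_n / S_α ≃ S_α \ S_n / S_β`. -/
def cosetInv {n : ℕ} (β α : Composition n) : DCoset β α ≃ DCoset α β where
  toFun := Quotient.lift (fun σ => DoubleCoset.mk (parabolic α) (parabolic β) σ⁻¹)
    (fun σ τ hst => (mk_inv_eq_iff β α σ τ).2 (Quotient.sound hst))
  invFun := Quotient.lift (fun σ => DoubleCoset.mk (parabolic β) (parabolic α) σ⁻¹)
    (fun σ τ hst => (mk_inv_eq_iff α β σ τ).2 (Quotient.sound hst))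
  left_inv := by
    rintro ⟨σ⟩
    exact congrArg (DoubleCoset.mk (parabolic β) (parabolic α)) (inv_inv σ)
  right_inv := by
    rintro ⟨σ⟩
    exact congrArg (DoubleCoset.mk (parabolic α) (parabolic β)) (inv_inv σ)

theorem cosetLength_cosetInv {n : ℕ} (β α : Composition n) (c : DCoset β α) :
    cosetLength (cosetInv β α c) = cosetLength c := by
  obtain ⟨τ, rfl⟩ : ∃ τ, DoubleCoset.mk (parabolic β) (parabolic α) τ = c := Quotient.exists_rep c
  have hc : cosetInv β α (DoubleCoset.mk (parabolic β) (parabolic α) τ) =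
      DoubleCoset.mk (parabolic α) (parabolic β) τ⁻¹ := rfl
  rw [hc, cosetLength, cosetLength]
  congr 1
  ext l
  constructor
  · rintro ⟨σ, hσ, rfl⟩
    refine ⟨σ⁻¹, (mk_inv_eq_iff β α _ _).1 (by rwa [inv_inv]), permLength_inv σ⟩
  · rintro ⟨σ, hσ, rfl⟩
    exact ⟨σ⁻¹, (mk_inv_eq_iff β α _ _).2 hσ, permLength_inv σ⟩

theorem signedCount_comm (R : Type*) [CommRing R] {n : ℕ} (β α : Composition n) :
    signedCount R β α = signedCount R α β :=
  finsum_eq_of_bijective (cosetInv β α) (cosetInv β α).bijective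
    (fun c => by rw [cosetLength_cosetInv])

theorem pairing_comm (R : Type*) [CommRing R] (v w : FreeMonoid ℕ+) :
    pairing R v w = pairing R w v := by
  have aux : ∀ (n m : ℕ) (hm : m = n) (hv : weight v = n) (hw : weight w = n)
      (hv' : weight v = m) (hw' : weight w = m),
      signedCount R (toComposition n v hv) (toComposition n w hw) =
        signedCount R (toComposition m w hw') (toComposition m v hv') := by
    rintro n m rfl hv hw hv' hw'
    exact signedCount_comm R _ _
  by_cases hvw : weight v = weight w
  · rw [pairing, pairing, dif_pos hvw, dif_pos hvw.symm]
    exact aux _ _ hvw _ _ _ _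
  · rw [pairing, pairing, dif_neg hvw, dif_neg (Ne.symm hvw)]

theorem freeForm_comm (R : Type*) [CommRing R] (x y : FreeH R) :
    freeForm R x y = freeForm R y x := by
  have : freeForm R = (freeForm R).flip := by
    refine (hBasis R).ext fun v => (hBasis R).ext fun w => ?_
    change freeForm R (hBasis R v) (hBasis R w) = freeForm R (hBasis R w) (hBasis R v)
    rw [hBasis_apply, hBasis_apply, freeForm_hWord, freeForm_hWord,
      pairing_comm]
  exact LinearMap.congr_fun₂ this x y

/-! ### The odd symmetric functions `Λ` -/

/-- The radical of the bilinear form on `Λ'`. -/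
def radical (R : Type*) [CommRing R] : Submodule R (FreeH R) := LinearMap.ker (freeForm R)

/-- The module `Λ = Λ' / radical` of odd symmetric functions. -/
abbrev OddSym (R : Type*) [CommRing R] : Type _ := FreeH R ⧸ radical R

/-- The projection `Λ' → Λ`. -/
def proj (R : Type*) [CommRing R] : FreeH R →ₗ[R] OddSym R := (radical R).mkQ

/-- The homogeneous part `Λ_n` of degree `n`. -/
def degreePart (R : Type*) [CommRing R] (n : ℕ) : Submodule R (OddSym R) :=
  (grading R n).map (proj R)

/-- The unit element of `Λ`. -/
def unit (R : Type*) [CommRing R] : OddSym R := proj R 1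

/-- The bilinear form induced on `Λ`. -/
def form (R : Type*) [CommRing R] : LinearMap.BilinForm R (OddSym R) :=
  (radical R).liftQ
    { toFun := fun x => (radical R).liftQ (freeForm R x) (fun y hy => by
        rw [LinearMap.mem_ker, freeForm_comm]
        exact LinearMap.congr_fun (LinearMap.mem_ker.1 hy) x)
      map_add' := fun x y => by
        refine Submodule.linearMap_qext _ (LinearMap.ext fun z => ?_)
        simp
      map_smul' := fun r x => by
        refine Submodule.linearMap_qext _ (LinearMap.ext fun z => ?_)
        simp }
    (fun x hx => by
      rw [LinearMap.mem_ker]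
      refine Submodule.linearMap_qext _ (LinearMap.ext fun z => ?_)
      exact LinearMap.congr_fun (LinearMap.mem_ker.1 hx) z)

theorem form_proj (R : Type*) [CommRing R] (x y : FreeH R) :
    form R (proj R x) (proj R y) = freeForm R x y := rfl

/-- `Δ` is the comultiplication that `Λ` inherits from `Λ'` along the projection. -/
def IsInheritedComul (R : Type*) [CommRing R] (Δ : OddSym R →ₗ[R] OddSym R ⊗[R] OddSym R) :
    Prop :=
  ∀ x : FreeH R, Δ (proj R x) = TensorProduct.map (proj R) (proj R) (freeComulLin R x)

/-- The subspace of primitive elements, `Δ x = 1 ⊗ x + x ⊗ 1`. -/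
def primitives (R : Type*) [CommRing R] (Δ : OddSym R →ₗ[R] OddSym R ⊗[R] OddSym R) :
    Submodule R (OddSym R) where
  carrier := {x | Δ x = unit R ⊗ₜ[R] x + x ⊗ₜ[R] unit R}
  zero_mem' := by simp
  add_mem' := by
    intro x y hx hy
    change Δ x = _ at hx
    change Δ y = _ at hy
    change Δ (x + y) = _
    rw [map_add, hx, hy, TensorProduct.tmul_add, TensorProduct.add_tmul]
    abel
  smul_mem' := by
    intro r x hx
    change Δ x = _ at hx
    change Δ (r • x) = _
    rw [map_smul, hx, smul_add, TensorProduct.tmul_smul]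
    rfl

/-- The odd complete symmetric function `h_λ = h_{λ₁} h_{λ₂} ⋯`, with `λ₁ ≥ λ₂ ≥ ⋯`. -/
def hPartition (R : Type*) [CommRing R] {n : ℕ} (p : n.Partition) : OddSym R :=
  proj R (((p.parts.sort (· ≥ ·)).map (h R)).prod)

/-- `m` is the family of odd monomial symmetric functions: for each `n`, the `m_λ` with `λ ⊢ n` lie
in `Λ_n` and are dual to the `h_λ` with `λ ⊢ n`. -/
def IsMonomialFamily (R : Type*) [CommRing R] (m : (n : ℕ) → n.Partition → OddSym R) : Prop :=
  ∀ n : ℕ, (∀ p : n.Partition, m n p ∈ degreePart R n) ∧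
    ∀ p q : n.Partition, form R (hPartition R p) (m n q) = if p = q then 1 else 0

/-- `m_n`, the member of the family `m` at the one-row partition `(n)`. -/
def oneRow {R : Type*} [CommRing R] (m : (n : ℕ) → n.Partition → OddSym R) (n : ℕ) : OddSym R :=
  m n (Nat.Partition.indiscrete n)

end OddSymm

end

noncomputable section

namespace OddSymm

/-! ### Double cosets of parabolic subgroups and matrices -/

/-! The form makes `Δ` adjoint to multiplication: `(xy, z) = (x ⊗ y, Δ z)`, with no sign in the
pairing of tensors (`freeForm_mul`). The double cosets in `(h_β, h_α)` are nonnegative integer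
matrices with margins `β` and `α`, and the minimal length counts the inversions forced by the
blocks. So `(h_β, h_α)` is the coefficient of `x^β` in the product of complete polynomials `h_{a_1}
⋯ h_{a_r}` in anticommuting variables, and splitting the variables into an initial and a final set
turns this coefficient into a coefficient of `Δ`. It follows that the radical is a two-sided ideal
and that `Δ` descends.

Adjointness also shows that `z` is primitive exactly when `z` is orthogonal to `1` and to all words
with at least two letters (`mem_primitives_iff`). A primitive element is therefore determined by its
pairings with the single letters `h_n`. What remains is to find out for which `n` the class of `h_n`
in `Λ` is decomposable.

This needs the relations of `Λ` and a basis. The elementary functions `e_k` represent the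
functionals that pick out `h_1^k`, and right multiplication by `e_k` is adjoint to a skewing
operator `elemSkew k` which satisfies a twisted Leibniz rule. Skewing preserves the radical and
detects it (`elemSkew_mem_radical`, `mem_radical_of_elemSkew`), so relations are checked by
induction on the degree (`hInt_relations`): `h_m` and `h_n` commute if `m + n` is even, and satisfy
a four-term relation if `m + n` is odd. The relations rewrite every word in decreasing words.
Skewing also proves that the decreasing words are independent, so the `h_λ` form a basis of `Λ` and
the dual family `m_λ` exists.

For `a` even the four-term relation contains `2 h_{a+1} = h_a h_1 + h_1 h_a`. If `a > 0`, a
primitive element is thus orthogonal to `h_{a+1}`, which excludes odd degrees from `3` on. In an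
even degree, straightening a word with at least two letters never produces the one-row term `h_n`
(`proj_hWord_mem_span`), so `m_n` is orthogonal to all such words and hence primitive. In degree `1`
there are no such words. -/

theorem exists_equiv_comp_eq {S T X : Type*} [Fintype S] [Fintype T] [DecidableEq X]
    (f : S → X) (g : T → X)
    (hfg : ∀ x, (Finset.univ.filter fun s => f s = x).card =
      (Finset.univ.filter fun t => g t = x).card) :
    ∃ e : S ≃ T, ∀ s, g (e s) = f s := by
  have key : ∀ x, Nonempty ({s // f s = x} ≃ {t // g t = x}) := by
    intro x
    refine Fintype.card_eq.1 ?_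
    rw [Fintype.card_subtype, Fintype.card_subtype, hfg x]
  let e := fun x => (key x).some
  exact ⟨Equiv.ofFiberEquiv e, Equiv.ofFiberEquiv_map e⟩

theorem monotone_index {n : ℕ} (c : Composition n) : Monotone c.index := by
  intro p q hpq
  by_contra hlt
  rw [not_le] at hlt
  have h1 := c.lt_sizeUpTo_index_succ q
  have h2 := c.sizeUpTo_index_le p
  have h3 : c.sizeUpTo (c.index q).succ ≤ c.sizeUpTo (c.index p) := by
    refine c.monotone_sizeUpTo ?_
    simpa using hlt
  have h4 : (p : ℕ) ≤ q := hpq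
  omega

theorem card_index_fiber {n : ℕ} (c : Composition n) (i : Fin c.length) :
    (Finset.univ.filter fun p => c.index p = i).card = c.blocksFun i := by
  have : (Finset.univ.filter fun p => c.index p = i) =
      Finset.univ.map (c.embedding i).toEmbedding := by
    ext p
    have := c.mem_range_embedding_iff' (j := p) (i := i)
    simp only [Finset.mem_filter, Finset.mem_univ, true_and, Finset.mem_map]
    rw [eq_comm, ← this]
    rfl
  rw [this, Finset.card_map, Finset.card_univ, Fintype.card_fin]

/-- The matrix of a permutation with respect to two compositions. -/
def blockMatrix {n : ℕ} (β α : Composition n) (σ : Equiv.Perm (Fin n)) :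
    Fin α.length → Fin β.length → ℕ :=
  fun j i => (Finset.univ.filter fun p => (α.index p, β.index (σ p)) = (j, i)).card

/-- Equal matrices give a bijection of `Fin n` that matches the pairs (block of `p`, block of the
image of `p`). This bijection is the `parabolic α` factor, and what is left over lies in `parabolic
β`. -/
theorem mk_eq_mk_iff {n : ℕ} (β α : Composition n) (σ τ : Equiv.Perm (Fin n)) :
    DoubleCoset.mk (parabolic β) (parabolic α) σ = DoubleCoset.mk (parabolic β) (parabolic α) τ ↔
      blockMatrix β α σ = blockMatrix β α τ := by
  rw [DoubleCoset.eq]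
  constructor
  · rintro ⟨u, hu, v, hv, rfl⟩
    funext j i
    refine Finset.card_equiv v⁻¹ fun p => ?_
    have h1 : α.index (v⁻¹ p) = α.index p := (parabolic α).inv_mem hv p
    have h2 : β.index (u (σ (v (v⁻¹ p)))) = β.index (σ p) := by
      rw [hu, show v (v⁻¹ p) = p from v.apply_symm_apply p]
    simp only [Finset.mem_filter, Finset.mem_univ, true_and, Prod.mk.injEq, Equiv.Perm.mul_apply,
      h1, h2]
  · intro h
    obtain ⟨e, he⟩ := exists_equiv_comp_eq (fun p => (α.index p, β.index (τ p)))
      (fun p => (α.index p, β.index (σ p))) (fun x => (congrFun (congrFun h x.1) x.2).symm)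
    simp only [Prod.mk.injEq] at he
    refine ⟨τ * e⁻¹ * σ⁻¹, fun p => ?_, e, fun p => (he p).1, by group⟩
    have := (he (e⁻¹ (σ⁻¹ p))).2
    simpa using this.symm

/-- A set with `A j i` elements in each cell `(j, i)` is matched with `Fin n` once along the
`α`-blocks and once along the `β`-blocks; the permutation compares the two matchings. -/
theorem exists_blockMatrix_eq {n : ℕ} (β α : Composition n)
    (A : Fin α.length → Fin β.length → ℕ) (hα : ∀ j, ∑ i, A j i = α.blocksFun j)
    (hβ : ∀ i, ∑ j, A j i = β.blocksFun i) : ∃ σ, blockMatrix β α σ = A := by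
  let X := Σ j : Fin α.length, Σ i : Fin β.length, Fin (A j i)
  have h1 : ∀ j, (Finset.univ.filter fun x : X => x.1 = j).card = α.blocksFun j := by
    intro j
    rw [Finset.card_filter, Fintype.sum_sigma, Finset.sum_eq_single j]
    · simp [hα]
    · intro j' _ hj'
      simp [hj']
    · simp
  have h2 : ∀ i, (Finset.univ.filter fun x : X => x.2.1 = i).card = β.blocksFun i := by
    intro i
    rw [Finset.card_filter, Fintype.sum_sigma, ← hβ i]
    refine Finset.sum_congr rfl fun j _ => ?_
    rw [Fintype.sum_sigma, Finset.sum_eq_single i]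
    · simp
    · intro i' _ hi'
      simp [hi']
    · simp
  obtain ⟨e₁, he₁⟩ := exists_equiv_comp_eq (fun p => α.index p) (fun x : X => x.1)
    (fun j => by rw [card_index_fiber, h1])
  obtain ⟨e₂, he₂⟩ := exists_equiv_comp_eq (fun x : X => x.2.1) (fun p => β.index p)
    (fun j => by rw [card_index_fiber, h2])
  refine ⟨e₁.trans e₂, funext fun j => funext fun i => ?_⟩
  have : blockMatrix β α (e₁.trans e₂) j i =
      (Finset.univ.filter fun x : X => (x.1, x.2.1) = (j, i)).card := by
    refine Finset.card_equiv e₁ fun p => ?_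
    simp [he₁, he₂]
  rw [this, Finset.card_filter, Fintype.sum_sigma, Finset.sum_eq_single j]
  · rw [Fintype.sum_sigma, Finset.sum_eq_single i]
    · simp
    · intro i' _ hi'
      simp [hi']
    · simp
  · intro j' _ hj'
    simp [hj']
  · simp

/-- The number of transpositions of a variable of `d` past a later variable of `c`. -/
def twist {ι : Type*} [Fintype ι] (r : ι → ι → Prop) [DecidableRel r] (c d : ι → ℕ) : ℕ :=
  ∑ i, ∑ k, if r i k then c k * d i else 0

/-- The exponent of the sign attached to a matrix given by its columns. -/
def crossing {ι : Type*} [Fintype ι] (r : ι → ι → Prop) [DecidableRel r] {m : ℕ}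
    (A : Fin m → ι → ℕ) : ℕ :=
  ∑ l, ∑ j, if l < j then twist r (A l) (A j) else 0

/-- The set of pairs which are inverted by all elements of the double coset. -/
def blockInversions {n : ℕ} (β α : Composition n) (σ : Equiv.Perm (Fin n)) :
    Finset (Fin n × Fin n) :=
  Finset.univ.filter fun p => α.index p.1 < α.index p.2 ∧ β.index (σ p.2) < β.index (σ p.1)

/-! ### Minimal length in a double coset -/

theorem card_filter_rel {T X : Type*} [Fintype T] [Fintype X] [DecidableEq X] (c : T → X)
    (P : X → X → Prop) [DecidableRel P] :
    (Finset.univ.filter fun p : T × T => P (c p.1) (c p.2)).card =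
      ∑ x, ∑ y, if P x y then (Finset.univ.filter fun t => c t = x).card *
        (Finset.univ.filter fun t => c t = y).card else 0 := by
  rw [← Fintype.sum_prod_type', Finset.card_eq_sum_card_fiberwise (t := Finset.univ)
    (f := fun p : T × T => (c p.1, c p.2)) (by simp)]
  refine Finset.sum_congr rfl fun x _ => ?_
  rw [← Finset.card_product, ← Finset.filter_product, Finset.filter_filter]
  split_ifs with h
  · congr 1
    ext p
    simp only [Finset.mem_filter, Finset.mem_univ, true_and, Finset.univ_product_univ]
    constructor
    · rintro ⟨-, rfl⟩
      simp
    · rintro ⟨h1, h2⟩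
      rw [h1, h2]
      exact ⟨h, rfl⟩
  · rw [Finset.card_eq_zero, Finset.filter_eq_empty_iff]
    rintro p - ⟨h1, rfl⟩
    exact h h1

theorem card_blockInversions {n : ℕ} (β α : Composition n) (σ : Equiv.Perm (Fin n)) :
    (blockInversions β α σ).card = crossing (· < ·) (blockMatrix β α σ) := by
  have := card_filter_rel (fun p => (α.index p, β.index (σ p)))
    (fun x y => x.1 < y.1 ∧ y.2 < x.2)
  rw [blockInversions, this, crossing, Fintype.sum_prod_type]
  refine Finset.sum_congr rfl fun l _ => ?_
  simp_rw [Fintype.sum_prod_type]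
  rw [Finset.sum_comm]
  refine Finset.sum_congr rfl fun j _ => ?_
  rw [twist, Finset.sum_comm]
  by_cases h : l < j
  · simp [h, blockMatrix]
  · simp [h]

theorem blockInversions_subset {n : ℕ} (β α : Composition n) (σ : Equiv.Perm (Fin n)) :
    blockInversions β α σ ⊆
      Finset.univ.filter (fun p : Fin n × Fin n => p.1 < p.2 ∧ σ p.2 < σ p.1) := by
  intro p hp
  simp only [blockInversions, Finset.mem_filter, Finset.mem_univ, true_and] at hp ⊢
  exact ⟨(monotone_index α).reflect_lt hp.1, (monotone_index β).reflect_lt hp.2⟩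

/-- The shortest representative arises by sorting inside the `α`-blocks and then breaking ties
stably inside the `β`-blocks; afterwards only the inversions forced by the blocks remain. -/
theorem exists_permLength_eq {n : ℕ} (β α : Composition n) (σ : Equiv.Perm (Fin n)) :
    ∃ σ', DoubleCoset.mk (parabolic β) (parabolic α) σ' =
        DoubleCoset.mk (parabolic β) (parabolic α) σ ∧
      permLength σ' = crossing (· < ·) (blockMatrix β α σ) := by
  let g : Fin n → Fin α.length ×ₗ Fin β.length := fun p => toLex (α.index p, β.index (σ p))
  -- The lexicographic key puts the `α`-block first, so this sort stays inside the `α`-blocks and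
  -- makes `f` below weakly increasing on each of them.
  let τ := Tuple.sort g
  have hg : Monotone (g ∘ τ) := Tuple.monotone_sort g
  have hτ : ∀ p, α.index (τ p) = α.index p := by
    have h1 : Monotone (α.index ∘ τ) := fun p q hpq => by
      rcases Prod.Lex.toLex_le_toLex.1 (hg hpq) with h | h
      · exact h.le
      · exact h.1.le
    exact congrFun (Tuple.unique_monotone (σ := τ) (τ := 1) h1 (monotone_index α))
  let f : Fin n → Fin β.length := fun p => β.index (σ (τ p))
  have hf : ∀ p q, p ≤ q → α.index p = α.index q → f p ≤ f q := by
    intro p q hpq h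
    rw [← hτ p, ← hτ q] at h
    rcases Prod.Lex.toLex_le_toLex.1 (hg hpq) with h' | h'
    · exact absurd h h'.ne
    · exact h'.2
  -- `Tuple.sort` is stable: ties keep their order. Hence `ρ⁻¹` has no inversion inside a `β`-block.
  let ρ := Tuple.sort f
  obtain ⟨hρ, hρ'⟩ := Tuple.eq_sort_iff.1 (rfl : ρ = Tuple.sort f)
  have hρβ : ∀ p, f (ρ p) = β.index p :=
    congrFun (Tuple.unique_monotone (f := β.index) (σ := ρ.trans (τ.trans σ)) (τ := 1) hρ
      (monotone_index β))
  have hmk : DoubleCoset.mk (parabolic β) (parabolic α) ρ⁻¹ =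
        DoubleCoset.mk (parabolic β) (parabolic α) σ := by
    rw [DoubleCoset.eq]
    refine ⟨σ * τ * ρ, fun p => hρβ p, τ⁻¹, (parabolic α).inv_mem hτ, by group⟩
  refine ⟨ρ⁻¹, hmk, ?_⟩
  rw [← (mk_eq_mk_iff β α _ _).1 hmk, ← card_blockInversions, permLength]
  congr 1
  refine Finset.Subset.antisymm (fun p hp => ?_) (blockInversions_subset β α _)
  simp only [blockInversions, Finset.mem_filter, Finset.mem_univ, true_and] at hp ⊢
  obtain ⟨h1, h2⟩ := hp
  have hinv : ∀ p, ρ (ρ⁻¹ p) = p := ρ.apply_symm_apply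
  have hfρ : ∀ p, β.index (ρ⁻¹ p) = f p := fun p => by rw [← hρβ, hinv]
  have h3 : f p.2 < f p.1 := by
    have := hρ h2.le
    simp only [Function.comp_apply, hinv] at this
    refine lt_of_le_of_ne this fun h4 => ?_
    have := hρ' _ _ h2 (by simpa only [hinv] using h4)
    simp only [hinv] at this
    exact absurd h1 this.not_gt
  rw [hfρ, hfρ]
  refine ⟨lt_of_le_of_ne (monotone_index α h1.le) fun h4 => ?_, h3⟩
  exact absurd h3 (hf _ _ h1.le h4).not_gt

theorem cosetLength_mk {n : ℕ} (β α : Composition n) (σ : Equiv.Perm (Fin n)) :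
    cosetLength (DoubleCoset.mk (parabolic β) (parabolic α) σ : DCoset β α) =
      crossing (· < ·) (blockMatrix β α σ) := by
  obtain ⟨σ', h1, h2⟩ := exists_permLength_eq β α σ
  refine le_antisymm (Nat.sInf_le ⟨σ', h1, h2⟩) (le_csInf ⟨_, σ', h1, h2⟩ ?_)
  rintro _ ⟨τ, hτ, rfl⟩
  rw [← (mk_eq_mk_iff β α _ _).1 hτ, ← card_blockInversions]
  exact Finset.card_le_card (blockInversions_subset β α τ)

/-- The matrices with given column sums `α`, filtered by their row sums `β`. -/
def marginMatrices {ι : Type*} [Fintype ι] [DecidableEq ι] {m : ℕ} (β : ι → ℕ) (α : Fin m → ℕ) :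
    Finset (Fin m → ι → ℕ) :=
  (Fintype.piFinset fun j => Finset.piAntidiag Finset.univ (α j)).filter
    fun A => ∀ i, ∑ j, A j i = β i

theorem mem_marginMatrices {ι : Type*} [Fintype ι] [DecidableEq ι] {m : ℕ} {β : ι → ℕ}
    {α : Fin m → ℕ} {A : Fin m → ι → ℕ} :
    A ∈ marginMatrices β α ↔ (∀ j, ∑ i, A j i = α j) ∧ ∀ i, ∑ j, A j i = β i := by
  simp [marginMatrices]

theorem blockMatrix_mem {n : ℕ} (β α : Composition n) (σ : Equiv.Perm (Fin n)) :
    blockMatrix β α σ ∈ marginMatrices β.blocksFun α.blocksFun := by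
  rw [mem_marginMatrices]
  constructor
  · intro j
    rw [← card_index_fiber α j, Finset.card_eq_sum_card_fiberwise (t := Finset.univ)
      (f := fun p => β.index (σ p)) (by simp)]
    refine Finset.sum_congr rfl fun i _ => ?_
    rw [blockMatrix, Finset.filter_filter]
    simp
  · intro i
    have : β.blocksFun i = (Finset.univ.filter fun p => β.index (σ p) = i).card := by
      rw [← card_index_fiber β i]
      exact (Finset.card_equiv σ fun p => by simp).symm
    rw [this, Finset.card_eq_sum_card_fiberwise (t := Finset.univ)
      (f := fun p => α.index p) (by simp)]
    refine Finset.sum_congr rfl fun j _ => ?_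
    rw [blockMatrix, Finset.filter_filter]
    simp [and_comm]

/-- The signed count of double cosets as a signed sum over matrices. -/
theorem signedCount_eq_sum (R : Type*) [CommRing R] {n : ℕ} (β α : Composition n) :
    signedCount R β α =
      ∑ A ∈ marginMatrices β.blocksFun α.blocksFun, (-1 : R) ^ crossing (· < ·) A := by
  rw [signedCount, ← finsum_mem_coe_finset]
  let F : DCoset β α → (Fin α.length → Fin β.length → ℕ) :=
    Quotient.lift (blockMatrix β α)
      (fun σ τ hst => (mk_eq_mk_iff β α σ τ).1 (Quotient.sound hst))
  have hF : ∀ σ, F (DoubleCoset.mk (parabolic β) (parabolic α) σ) = blockMatrix β α σ :=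
    fun _ => rfl
  rw [← finsum_mem_univ]
  refine finsum_mem_eq_of_bijOn F ⟨?_, ?_, ?_⟩ ?_
  · rintro ⟨σ⟩ -
    exact blockMatrix_mem β α σ
  · rintro ⟨σ⟩ - ⟨τ⟩ - h
    exact (mk_eq_mk_iff β α σ τ).2 h
  · intro A hA
    obtain ⟨h1, h2⟩ := mem_marginMatrices.1 hA
    obtain ⟨σ, rfl⟩ := exists_blockMatrix_eq β α A h1 h2
    exact ⟨DoubleCoset.mk (parabolic β) (parabolic α) σ, trivial, hF σ⟩
  · rintro ⟨σ⟩ -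
    exact congrArg ((-1 : R) ^ ·) (cosetLength_mk β α σ)

/-! ### Words -/

theorem hWord_one (R : Type*) [CommRing R] : hWord R 1 = 1 := by simp [hWord]

theorem hWord_mul (R : Type*) [CommRing R] (u v : FreeMonoid ℕ+) :
    hWord R (u * v) = hWord R u * hWord R v := by simp [hWord]

theorem h_zero (R : Type*) [CommRing R] : h R 0 = 1 := by simp [h]

theorem h_coe (R : Type*) [CommRing R] (a : ℕ+) : h R a = FreeAlgebra.ι R a :=
  dif_pos a.pos

theorem hWord_of (R : Type*) [CommRing R] (a : ℕ+) : hWord R (FreeMonoid.of a) = h R a := by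
  rw [h_coe]
  simp [hWord]

theorem h_mem (R : Type*) [CommRing R] (n : ℕ) : h R n ∈ grading R n := by
  rcases Nat.eq_zero_or_pos n with rfl | hn
  · rw [h_zero]
    exact SetLike.GradedOne.one_mem
  · exact h_coe R ⟨n, hn⟩ ▸ ι_mem R ⟨n, hn⟩

theorem linearMap_ext_hWord {R M : Type*} [CommRing R] [AddCommMonoid M] [Module R M]
    {f g : FreeH R →ₗ[R] M} (hfg : ∀ w, f (hWord R w) = g (hWord R w)) : f = g :=
  (hBasis R).ext fun w => by rw [hBasis_apply, hfg]

theorem linearMap_ext_hWord_tmul {R M : Type*} [CommRing R] [AddCommMonoid M] [Module R M]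
    {f g : FreeH R ⊗[R] FreeH R →ₗ[R] M}
    (hfg : ∀ u v, f (hWord R u ⊗ₜ hWord R v) = g (hWord R u ⊗ₜ hWord R v)) : f = g := by
  refine TensorProduct.ext (linearMap_ext_hWord fun u => linearMap_ext_hWord fun v => ?_)
  exact hfg u v

/-! ### The multiplication of the graded tensor square -/

/-- The product of the graded tensor square, as a bilinear map on the tensor square. -/
def superMul (R : Type*) [CommRing R] :
    FreeH R ⊗[R] FreeH R →ₗ[R] FreeH R ⊗[R] FreeH R →ₗ[R] FreeH R ⊗[R] FreeH R :=
  ((LinearMap.mul R (GradedTensorProduct R (grading R) (grading R))).compl₁₂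
    (GradedTensorProduct.of R (grading R) (grading R)).toLinearMap
    (GradedTensorProduct.of R (grading R) (grading R)).toLinearMap).compr₂
    (GradedTensorProduct.of R (grading R) (grading R)).symm.toLinearMap

theorem superMul_tmul {R : Type*} [CommRing R] {i j : ℕ} (x : FreeH R) {y : FreeH R}
    (hy : y ∈ grading R j) {x' : FreeH R} (hx' : x' ∈ grading R i) (y' : FreeH R) :
    superMul R (x ⊗ₜ y) (x' ⊗ₜ y') = (-1 : R) ^ (j * i) • ((x * x') ⊗ₜ (y * y')) := by
  have := GradedTensorProduct.tmul_coe_mul_coe_tmul (grading R) (grading R) x ⟨y, hy⟩ ⟨x', hx'⟩ y'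
  refine Eq.trans (congrArg (GradedTensorProduct.of R (grading R) (grading R)).symm this) ?_
  rcases Nat.even_or_odd (j * i) with h | h
  · simp [h.neg_one_pow]
  · simp only [h.neg_one_pow, Units.neg_smul, one_smul, map_neg]
    rfl

theorem freeComulLin_mul (R : Type*) [CommRing R] (x y : FreeH R) :
    freeComulLin R (x * y) = superMul R (freeComulLin R x) (freeComulLin R y) := by
  simp [freeComulLin, superMul]

theorem freeComulLin_one (R : Type*) [CommRing R] : freeComulLin R 1 = 1 ⊗ₜ 1 := by
  simp [freeComulLin, Algebra.TensorProduct.one_def]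

theorem freeComulLin_h (R : Type*) [CommRing R] (a : ℕ) :
    freeComulLin R (h R a) = ∑ m ∈ Finset.range (a + 1), h R m ⊗ₜ h R (a - m) := by
  rcases Nat.eq_zero_or_pos a with rfl | ha
  · rw [h_zero, freeComulLin_one]
    simp [h_zero]
  · obtain ⟨a, rfl⟩ : ∃ b : ℕ+, (b : ℕ) = a := ⟨⟨a, ha⟩, rfl⟩
    rw [h_coe, freeComulLin, LinearMap.comp_apply, AlgHom.toLinearMap_apply, freeComul,
      FreeAlgebra.lift_ι_apply]
    simp

/-! ### Coefficients of skew polynomials -/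

section Coeff

variable {ι κ : Type*} [Fintype ι] [Fintype κ]

theorem twist_zero_left (r : ι → ι → Prop) [DecidableRel r] (d : ι → ℕ) : twist r 0 d = 0 := by
  simp [twist]

theorem twist_sum_right (r : ι → ι → Prop) [DecidableRel r] {m : ℕ} (c : ι → ℕ)
    (A : Fin m → ι → ℕ) : twist r c (∑ j, A j) = ∑ j, twist r c (A j) := by
  simp only [twist]
  rw [Finset.sum_comm (s := (Finset.univ : Finset (Fin m)))]
  refine Finset.sum_congr rfl fun i _ => ?_
  rw [Finset.sum_comm (s := (Finset.univ : Finset (Fin m)))]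
  refine Finset.sum_congr rfl fun k _ => ?_
  split_ifs
  · simp [Finset.mul_sum]
  · simp

theorem crossing_cons (r : ι → ι → Prop) [DecidableRel r] {m : ℕ} (c : ι → ℕ)
    (A : Fin m → ι → ℕ) :
    crossing r (Fin.cons c A : Fin (m + 1) → ι → ℕ) = twist r c (∑ j, A j) + crossing r A := by
  simp [crossing, Fin.sum_univ_succ, twist_sum_right]

/-- The extra product counts the second-set variables of the first monomial that pass the first-set
variables of the second. It is the Koszul sign of the graded tensor square. -/
theorem twist_sumElim (r : ι → ι → Prop) [DecidableRel r] (s : κ → κ → Prop) [DecidableRel s]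
    (c d : ι → ℕ) (c' d' : κ → ℕ) :
    twist (Sum.Lex r s) (Sum.elim c c') (Sum.elim d d') =
      twist r c d + twist s c' d' + (∑ k, c' k) * ∑ i, d i := by
  simp only [twist, Fintype.sum_sum_type, Sum.elim_inl, Sum.elim_inr, Sum.lex_inl_inl,
    Sum.lex_inr_inr, Sum.Lex.sep, Sum.lex_inr_inl, if_true, if_false, Finset.sum_const_zero,
    Finset.sum_add_distrib]
  rw [Finset.sum_mul_sum, Finset.sum_comm (f := fun x y => c' x * d y)]
  ring

theorem twist_comp (r : ι → ι → Prop) [DecidableRel r] (s : κ → κ → Prop) [DecidableRel s]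
    (e : ι ≃ κ) (he : ∀ i k, r i k ↔ s (e i) (e k)) (c d : κ → ℕ) :
    twist r (c ∘ e) (d ∘ e) = twist s c d := by
  simp only [twist, he, Function.comp_apply]
  rw [e.sum_comp (fun i => ∑ k, if s i (e k) then c (e k) * d i else 0)]
  exact Finset.sum_congr rfl fun i _ =>
    e.sum_comp (fun k => if s i k then c k * d i else 0)

variable [DecidableEq ι] [DecidableEq κ] (R : Type*) [CommRing R]

/-- The coefficient of `x^β` in the product of the complete skew polynomials of degrees given
by a list, the variables being ordered by `r`. -/
def coeffWord (r : ι → ι → Prop) [DecidableRel r] : List ℕ → (ι → ℕ) → R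
  | [], β => if β = 0 then 1 else 0
  | a :: l, β => ∑ c ∈ Finset.Iic β,
      if ∑ i, c i = a then (-1 : R) ^ twist r c (β - c) * coeffWord r l (β - c) else 0

/-- Peeling off the first column of the matrix amounts to choosing the monomial `x^c` contributed by
the first factor; the other columns add up to `β - c`. -/
theorem sum_marginMatrices (r : ι → ι → Prop) [DecidableRel r] {m : ℕ} (β : ι → ℕ)
    (α : Fin m → ℕ) :
    ∑ A ∈ marginMatrices β α, (-1 : R) ^ crossing r A = coeffWord R r (List.ofFn α) β := by
  induction m generalizing β with
  | zero =>
    rw [List.ofFn_zero, coeffWord]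
    have : marginMatrices β α = if β = 0 then Finset.univ else ∅ := by
      ext A
      rw [mem_marginMatrices]
      split_ifs with h
      · simpa [h] using Subsingleton.elim _ _
      · simpa [funext_iff, eq_comm] using h
    rw [this]
    split_ifs <;> simp [crossing]
  | succ m ih =>
    rw [List.ofFn_succ, coeffWord, ← Finset.sum_filter]
    simp_rw [← ih, Finset.mul_sum]
    rw [Finset.sum_sigma']
    refine Finset.sum_bij' (fun A _ => ⟨A 0, fun j => A j.succ⟩)
      (fun x _ => Fin.cons x.1 x.2) ?_ ?_ ?_ ?_ ?_
    · intro A hA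
      rw [mem_marginMatrices] at hA
      obtain ⟨h1, h2⟩ := hA
      simp only [Fin.sum_univ_succ] at h2
      simp only [Finset.mem_sigma, Finset.mem_filter, Finset.mem_Iic, mem_marginMatrices]
      refine ⟨⟨fun i => by rw [← h2]; simp, h1 0⟩, fun j => h1 j.succ, fun i => ?_⟩
      rw [Pi.sub_apply, ← h2]
      simp
    · rintro ⟨c, A⟩ h
      simp only [Finset.mem_sigma, Finset.mem_filter, Finset.mem_Iic, mem_marginMatrices] at h
      obtain ⟨⟨h1, h2⟩, h3, h4⟩ := h
      rw [mem_marginMatrices]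
      refine ⟨Fin.cases h2 h3, fun i => ?_⟩
      have : c i ≤ β i := h1 i
      simp only [Fin.sum_univ_succ, Fin.cons_zero, Fin.cons_succ, h4, Pi.sub_apply]
      omega
    · intro A _
      exact Fin.cons_self_tail A
    · rintro ⟨c, A⟩ _
      simp
    · intro A hA
      rw [mem_marginMatrices] at hA
      obtain ⟨h1, h2⟩ := hA
      have h3 : β - A 0 = ∑ j : Fin m, A j.succ := by
        funext i
        rw [Pi.sub_apply, ← h2, Fin.sum_univ_succ]
        simp
      rw [← Fin.cons_self_tail A, crossing_cons, pow_add]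
      simp only [Fin.cons_zero, Fin.cons_succ, h3]
      rfl

/-- The linear functional on `Λ'` whose value on a word is the coefficient of `x^β`. -/
def coeffFun (r : ι → ι → Prop) [DecidableRel r] (β : ι → ℕ) : FreeH R →ₗ[R] R :=
  (hBasis R).constr R fun w => coeffWord R r (w.toList.map (fun a : ℕ+ => (a : ℕ))) β

variable {R}

theorem coeffFun_hWord (r : ι → ι → Prop) [DecidableRel r] (β : ι → ℕ) (w : FreeMonoid ℕ+) :
    coeffFun R r β (hWord R w) = coeffWord R r (w.toList.map (fun a : ℕ+ => (a : ℕ))) β := by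
  rw [coeffFun, ← hBasis_apply, Module.Basis.constr_basis]

theorem coeffFun_one (r : ι → ι → Prop) [DecidableRel r] (β : ι → ℕ) :
    coeffFun R r β 1 = if β = 0 then 1 else 0 := by
  rw [← hWord_one, coeffFun_hWord]
  rfl

/-- Extends the recursion for `coeffWord` from words to all of `Λ'` and to `a = 0`, where only `c =
0` contributes. -/
theorem coeffFun_h_mul (r : ι → ι → Prop) [DecidableRel r] (β : ι → ℕ) (a : ℕ) (z : FreeH R) :
    coeffFun R r β (h R a * z) = ∑ c ∈ Finset.Iic β,
      if ∑ i, c i = a then (-1 : R) ^ twist r c (β - c) * coeffFun R r (β - c) z else 0 := by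
  rcases Nat.eq_zero_or_pos a with rfl | ha
  · rw [h_zero, one_mul, Finset.sum_eq_single 0]
    · simp [twist_zero_left]
    · intro c _ hc
      rw [if_neg]
      simpa [funext_iff] using hc
    · simp
  · obtain ⟨a, rfl⟩ : ∃ b : ℕ+, (b : ℕ) = a := ⟨⟨a, ha⟩, rfl⟩
    have : coeffFun R r β ∘ₗ LinearMap.mulLeft R (h R a) = ∑ c ∈ Finset.Iic β,
        if ∑ i, c i = a then (-1 : R) ^ twist r c (β - c) • coeffFun R r (β - c) else 0 := by
      refine linearMap_ext_hWord fun w => ?_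
      rw [LinearMap.comp_apply, LinearMap.mulLeft_apply, ← hWord_of, ← hWord_mul,
        coeffFun_hWord]
      simp only [FreeMonoid.toList_mul, FreeMonoid.toList_of, List.map_cons,
        List.singleton_append, coeffWord, LinearMap.sum_apply]
      refine Finset.sum_congr rfl fun c _ => ?_
      split_ifs <;> simp [coeffFun_hWord]
    have := LinearMap.congr_fun this z
    rw [LinearMap.comp_apply, LinearMap.mulLeft_apply] at this
    rw [this, LinearMap.sum_apply]
    refine Finset.sum_congr rfl fun c _ => ?_
    split_ifs <;> simp

theorem coeffFun_eq_zero (r : ι → ι → Prop) [DecidableRel r] (β : ι → ℕ) (w : FreeMonoid ℕ+)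
    (hw : weight w ≠ ∑ i, β i) : coeffFun R r β (hWord R w) = 0 := by
  induction w using FreeMonoid.inductionOn' generalizing β with
  | one =>
    rw [hWord_one, coeffFun_one, if_neg]
    rintro rfl
    simp [weight_one] at hw
  | of_mul a w ih =>
    rw [hWord_mul, hWord_of, coeffFun_h_mul]
    refine Finset.sum_eq_zero fun c hc => ?_
    split_ifs with h
    · rw [ih, mul_zero]
      rintro h'
      apply hw
      rw [weight_mul, weight_of, h', ← h, ← Finset.sum_add_distrib]
      refine Finset.sum_congr rfl fun i _ => ?_
      have : c i ≤ β i := Finset.mem_Iic.1 hc i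
      simp only [Pi.sub_apply]
      omega
    · rfl

/-- The coefficients depend on the variables only up to an isomorphism of the relation that orders
them. -/
theorem coeffFun_comp (r : ι → ι → Prop) [DecidableRel r] (s : κ → κ → Prop) [DecidableRel s]
    (e : ι ≃ κ) (he : ∀ i k, r i k ↔ s (e i) (e k)) (β : κ → ℕ) :
    coeffFun R r (β ∘ e) = coeffFun R s β := by
  refine linearMap_ext_hWord fun w => ?_
  induction w using FreeMonoid.inductionOn' generalizing β with
  | one =>
    rw [hWord_one, coeffFun_one, coeffFun_one]
    congr 1
    rw [← (e.arrowCongr (Equiv.refl ℕ)).symm.injective.eq_iff (a := β)]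
    rfl
  | of_mul a w ih =>
    rw [hWord_mul, hWord_of, coeffFun_h_mul, coeffFun_h_mul]
    refine Finset.sum_equiv (e.arrowCongr (Equiv.refl ℕ)) (fun c => ?_) fun c _ => ?_
    · simp only [Finset.mem_Iic, Pi.le_def, e.forall_congr_left]
      simp
    · obtain ⟨c, rfl⟩ := (e.arrowCongr (Equiv.refl ℕ)).symm.surjective c
      have h1 : (e.arrowCongr (Equiv.refl ℕ)).symm c = c ∘ e := rfl
      have h2 : β ∘ e - c ∘ e = (β - c) ∘ e := rfl
      rw [Equiv.apply_symm_apply, h1, h2, ih, twist_comp r s e he]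
      simp only [Function.comp_apply, e.sum_comp c]

/-- The functional `φ ⊗ ψ`. -/
def tensorFun {V : Type*} [AddCommGroup V] [Module R V] (φ ψ : V →ₗ[R] R) : V ⊗[R] V →ₗ[R] R :=
  LinearMap.mul' R R ∘ₗ TensorProduct.map φ ψ

theorem tensorFun_tmul {V : Type*} [AddCommGroup V] [Module R V] (φ ψ : V →ₗ[R] R) (x y : V) :
    tensorFun φ ψ (x ⊗ₜ y) = φ x * ψ y := by simp [tensorFun]

theorem tensorFun_coeffFun_superMul (r : ι → ι → Prop) [DecidableRel r] (s : κ → κ → Prop)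
    [DecidableRel s] (β : ι → ℕ) (γ : κ → ℕ) (m l : ℕ) (Y : FreeH R ⊗[R] FreeH R) :
    tensorFun (coeffFun R r β) (coeffFun R s γ) (superMul R (h R m ⊗ₜ h R l) Y) =
      ∑ c ∈ Finset.Iic β, ∑ d ∈ Finset.Iic γ, if ∑ i, c i = m ∧ ∑ k, d k = l then
        (-1 : R) ^ twist (Sum.Lex r s) (Sum.elim c d) (Sum.elim (β - c) (γ - d)) *
          tensorFun (coeffFun R r (β - c)) (coeffFun R s (γ - d)) Y else 0 := by
  have : tensorFun (coeffFun R r β) (coeffFun R s γ) ∘ₗ superMul R (h R m ⊗ₜ h R l) =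
      ∑ c ∈ Finset.Iic β, ∑ d ∈ Finset.Iic γ, if ∑ i, c i = m ∧ ∑ k, d k = l then
        (-1 : R) ^ twist (Sum.Lex r s) (Sum.elim c d) (Sum.elim (β - c) (γ - d)) •
          tensorFun (coeffFun R r (β - c)) (coeffFun R s (γ - d)) else 0 := by
    refine linearMap_ext_hWord_tmul fun u v => ?_
    rw [LinearMap.comp_apply, superMul_tmul _ (h_mem R l) (hWord_mem R u), map_smul,
      tensorFun_tmul, coeffFun_h_mul, coeffFun_h_mul, Finset.sum_mul_sum, Finset.smul_sum,
      LinearMap.sum_apply]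
    refine Finset.sum_congr rfl fun c _ => ?_
    rw [Finset.smul_sum, LinearMap.sum_apply]
    refine Finset.sum_congr rfl fun d _ => ?_
    by_cases h1 : ∑ i, c i = m
    · by_cases h2 : ∑ k, d k = l
      · rw [if_pos h1, if_pos h2, if_pos ⟨h1, h2⟩, LinearMap.smul_apply, tensorFun_tmul,
          twist_sumElim, h2]
        -- The multiplication produces a sign in the degree of `u`, the twist one in the degree of
        -- `β - c`. They can differ only where the coefficient of `hWord R u` vanishes.
        by_cases h3 : weight u = ∑ i, (β - c) i
        · rw [← h3, pow_add, pow_add, smul_eq_mul, smul_eq_mul]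
          ring
        · rw [coeffFun_eq_zero _ _ _ h3]
          simp
      · simp [h2]
    · simp [h1]
  have := LinearMap.congr_fun this Y
  rw [LinearMap.comp_apply] at this
  rw [this, LinearMap.sum_apply]
  refine Finset.sum_congr rfl fun c _ => ?_
  rw [LinearMap.sum_apply]
  refine Finset.sum_congr rfl fun d _ => ?_
  split_ifs <;> simp

/-- Substituting two ordered sets of variables, one after the other, into `z` is the same as
applying `Δ` and substituting one set into each factor. On letters this is `Δ h_a = ∑ h_m ⊗
h_{a-m}`, and the signs agree by `twist_sumElim`. -/
theorem coeffFun_sumElim (r : ι → ι → Prop) [DecidableRel r] (s : κ → κ → Prop)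
    [DecidableRel s] (β : ι → ℕ) (γ : κ → ℕ) (z : FreeH R) :
    coeffFun R (Sum.Lex r s) (Sum.elim β γ) z =
      tensorFun (coeffFun R r β) (coeffFun R s γ) (freeComulLin R z) := by
  refine LinearMap.congr_fun (f := coeffFun R (Sum.Lex r s) (Sum.elim β γ))
    (g := tensorFun (coeffFun R r β) (coeffFun R s γ) ∘ₗ freeComulLin R)
    (linearMap_ext_hWord fun w => ?_) z
  rw [LinearMap.comp_apply]
  induction w using FreeMonoid.inductionOn' generalizing β γ with
  | one =>
    rw [hWord_one, coeffFun_one, freeComulLin_one, tensorFun_tmul, coeffFun_one, coeffFun_one,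
      ite_zero_mul_ite_zero, one_mul]
    congr 1
    simp [funext_iff]
  | of_mul a w ih =>
    rw [hWord_mul, hWord_of, coeffFun_h_mul, freeComulLin_mul, freeComulLin_h, map_sum,
      LinearMap.sum_apply, map_sum]
    simp_rw [tensorFun_coeffFun_superMul, ← ih]
    rw [Finset.sum_comm]
    simp_rw [Finset.sum_comm (s := Finset.range _)]
    rw [← Finset.sum_product']
    refine Finset.sum_equiv (Equiv.sumArrowEquivProdArrow ι κ ℕ) (fun c => ?_) fun c _ => ?_
    · simp [Pi.le_def]
    · obtain ⟨⟨c, d⟩, rfl⟩ := (Equiv.sumArrowEquivProdArrow ι κ ℕ).symm.surjective c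
      have h1 : (Equiv.sumArrowEquivProdArrow ι κ ℕ).symm (c, d) = Sum.elim c d := rfl
      have h2 : Sum.elim β γ - Sum.elim c d = Sum.elim (β - c) (γ - d) := by
        ext x
        cases x <;> rfl
      rw [Equiv.apply_symm_apply, h1, h2]
      simp only [Fintype.sum_sum_type, Sum.elim_inl, Sum.elim_inr]
      split_ifs with h
      -- The degree of the part of the monomial in the first set of variables selects the summand
      -- `h_m ⊗ h_{a-m}`.
      · rw [Finset.sum_eq_single (∑ i, c i)]
        · rw [if_pos ⟨rfl, by omega⟩]
        · intro m _ hm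
          rw [if_neg fun h => hm h.1.symm]
        · intro hm
          exact absurd (Finset.mem_range.2 (by omega)) hm
      · refine (Finset.sum_eq_zero fun m hm => if_neg fun h' => h ?_).symm
        have := Finset.mem_range.1 hm
        omega

end Coeff

/-! ### The bilinear form and the comultiplication are adjoint -/

/-- The exponents of a word. -/
def letters (w : FreeMonoid ℕ+) (i : Fin w.toList.length) : ℕ := (w.toList.get i : ℕ+)

theorem sum_letters (w : FreeMonoid ℕ+) : ∑ i, letters w i = weight w :=
  Fin.sum_univ_fun_getElem w.toList (fun a : ℕ+ => (a : ℕ))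

theorem freeForm_eq_coeffFun (R : Type*) [CommRing R] (v : FreeMonoid ℕ+) :
    freeForm R (hWord R v) = coeffFun R (· < ·) (letters v) := by
  refine linearMap_ext_hWord fun w => ?_
  by_cases hvw : weight v = weight w
  · rw [freeForm_hWord, pairing, dif_pos hvw, signedCount_eq_sum, sum_marginMatrices,
      Composition.ofFn_blocksFun]
    have := coeffFun_comp (R := R) (· < ·) (· < ·) (finCongr (show v.toList.length =
      (toComposition (weight w) v hvw).length by simp [toComposition, Composition.length]))
      (fun i k => by simp) (toComposition (weight w) v hvw).blocksFun
    refine (coeffFun_hWord (R := R) (· < ·) _ w).symm.trans ?_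
    rw [← this]
    congr 2
    funext i
    simp [letters, toComposition, Composition.blocksFun]
    rfl
  · rw [freeForm_hWord, pairing, dif_neg hvw, coeffFun_eq_zero]
    rw [sum_letters]
    exact fun h => hvw h.symm

/-- The variables for the word `u * v` are those for `u` followed by those for `v`, so this is
`coeffFun_sumElim` read through `freeForm_eq_coeffFun`. -/
theorem freeForm_mul_hWord (R : Type*) [CommRing R] (u v : FreeMonoid ℕ+) :
    freeForm R (hWord R u * hWord R v) =
      tensorFun (freeForm R (hWord R u)) (freeForm R (hWord R v)) ∘ₗ freeComulLin R := by
  refine LinearMap.ext fun z => ?_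
  rw [← hWord_mul, freeForm_eq_coeffFun, freeForm_eq_coeffFun, freeForm_eq_coeffFun,
    LinearMap.comp_apply, ← coeffFun_sumElim]
  have := coeffFun_comp (R := R) (Sum.Lex (· < ·) (· < ·)) (· < ·)
    (finSumFinEquiv.trans (finCongr (show u.toList.length + v.toList.length =
      (u * v).toList.length by simp)))
    (fun i k => by
      rcases i with i | i <;> rcases k with k | k <;>
        have hi := i.isLt <;> have hk := k.isLt <;>
        simp only [Sum.lex_inl_inl, Sum.lex_inr_inr, Sum.lex_inr_inl, Sum.Lex.sep,
          Equiv.trans_apply, finSumFinEquiv_apply_left, finSumFinEquiv_apply_right,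
          finCongr_apply, Fin.lt_def, Fin.val_cast, Fin.val_castAdd, Fin.val_natAdd,
          true_iff, false_iff] <;> omega) (letters (u * v))
  rw [← this]
  congr 2
  funext i
  rcases i with i | i
  · change letters (u * v) _ = letters u i
    simp only [letters, List.get_eq_getElem, FreeMonoid.toList_mul]
    exact congrArg _ (List.getElem_append_left i.isLt)
  · change letters (u * v) _ = letters v i
    simp only [letters, List.get_eq_getElem, FreeMonoid.toList_mul]
    have key : ∀ (n : ℕ) (hn : n < (u.toList ++ v.toList).length), n = u.toList.length + i →
        (u.toList ++ v.toList)[n] = v.toList[i] := by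
      rintro n hn rfl
      simp
    exact congrArg _ (key _ _ rfl)

/-- The comultiplication is adjoint to the multiplication. -/
theorem freeForm_mul (R : Type*) [CommRing R] (x y z : FreeH R) :
    freeForm R (x * y) z = tensorFun (freeForm R x) (freeForm R y) (freeComulLin R z) := by
  have key : ((LinearMap.mul R (FreeH R)).compr₂ (freeForm R)) =
      LinearMap.mk₂ R (fun x y => tensorFun (freeForm R x) (freeForm R y) ∘ₗ freeComulLin R)
        (fun x x' y => by simp [tensorFun, TensorProduct.map_add_left, LinearMap.add_comp, LinearMap.comp_add])
        (fun c x y => by simp [tensorFun, TensorProduct.map_smul_left, LinearMap.smul_comp, LinearMap.comp_smul])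
        (fun x y y' => by simp [tensorFun, TensorProduct.map_add_right, LinearMap.add_comp, LinearMap.comp_add])
        (fun c x y => by simp [tensorFun, TensorProduct.map_smul_right, LinearMap.smul_comp, LinearMap.comp_smul]) :=
    linearMap_ext_hWord fun u => linearMap_ext_hWord fun v => freeForm_mul_hWord R u v
  exact LinearMap.congr_fun (LinearMap.congr_fun₂ key x y) z

/-! ### The radical is an ideal -/

theorem mem_radical_iff {R : Type*} [CommRing R] {x : FreeH R} :
    x ∈ radical R ↔ ∀ w, freeForm R (hWord R w) x = 0 := by
  rw [radical, LinearMap.mem_ker]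
  constructor
  · intro hx w
    rw [freeForm_comm, hx, LinearMap.zero_apply]
  · intro hx
    refine linearMap_ext_hWord fun w => ?_
    rw [freeForm_comm, hx, LinearMap.zero_apply]

theorem freeForm_eq_zero {R : Type*} [CommRing R] {x : FreeH R} (hx : x ∈ radical R)
    (y : FreeH R) : freeForm R y x = 0 := by
  rw [freeForm_comm, LinearMap.mem_ker.1 hx, LinearMap.zero_apply]

theorem mul_mem_radical_right {R : Type*} [CommRing R] {x : FreeH R} (hx : x ∈ radical R)
    (y : FreeH R) : x * y ∈ radical R := by
  refine LinearMap.mem_ker.2 (LinearMap.ext fun z => ?_)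
  rw [freeForm_mul, LinearMap.mem_ker.1 hx]
  simp [tensorFun]

theorem mul_mem_radical_left {R : Type*} [CommRing R] (y : FreeH R) {x : FreeH R}
    (hx : x ∈ radical R) : y * x ∈ radical R := by
  refine LinearMap.mem_ker.2 (LinearMap.ext fun z => ?_)
  rw [freeForm_mul, LinearMap.mem_ker.1 hx]
  simp [tensorFun]

/-! ### Orthogonality of degrees and pairings with single letters -/

theorem freeForm_hWord_of_ne {R : Type*} [CommRing R] {v w : FreeMonoid ℕ+}
    (hvw : weight v ≠ weight w) : freeForm R (hWord R v) (hWord R w) = 0 := by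
  rw [freeForm_hWord, pairing, dif_neg hvw]

theorem freeForm_eq_zero_of_mem {R : Type*} [CommRing R] {i j : ℕ} (hij : i ≠ j)
    {x y : FreeH R} (hx : x ∈ grading R i) (hy : y ∈ grading R j) : freeForm R x y = 0 := by
  induction hx using Submodule.span_induction with
  | mem x hx =>
    obtain ⟨v, rfl, rfl⟩ := hx
    induction hy using Submodule.span_induction with
    | mem y hy =>
      obtain ⟨w, rfl, rfl⟩ := hy
      exact freeForm_hWord_of_ne hij
    | zero => simp
    | add y y' _ _ ih ih' => rw [map_add, ih, ih', add_zero]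
    | smul c y _ ih => rw [map_smul, ih, smul_zero]
  | zero => simp
  | add x x' _ _ ih ih' => rw [map_add, LinearMap.add_apply, ih, ih', add_zero]
  | smul c x _ ih => rw [map_smul, LinearMap.smul_apply, ih, smul_zero]

/-- A complete polynomial contains every monomial of its degree exactly once, with coefficient `1`.
-/
theorem freeForm_hWord_h (R : Type*) [CommRing R] (w : FreeMonoid ℕ+) (n : ℕ) :
    freeForm R (hWord R w) (h R n) = if weight w = n then 1 else 0 := by
  split_ifs with hw
  · rw [freeForm_eq_coeffFun, ← mul_one (h R n), coeffFun_h_mul, Finset.sum_eq_single (letters w)]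
    · rw [if_pos ((sum_letters w).trans hw), coeffFun_one]
      simp [twist]
    · intro c hc hne
      rw [coeffFun_one, if_neg (c := _ - _ = _), mul_zero, ite_self]
      intro h0
      refine hne (le_antisymm (Finset.mem_Iic.1 hc) fun i => ?_)
      exact Nat.sub_eq_zero_iff_le.1 (congrFun h0 i)
    · simp
  · exact freeForm_eq_zero_of_mem hw (hWord_mem R w) (h_mem R n)

theorem freeForm_h_hWord (R : Type*) [CommRing R] (n : ℕ) (w : FreeMonoid ℕ+) :
    freeForm R (h R n) (hWord R w) = if weight w = n then 1 else 0 := by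
  rw [freeForm_comm, freeForm_hWord_h]

theorem eq_one_or_eq_mul_of (w : FreeMonoid ℕ+) :
    w = 1 ∨ ∃ (u : FreeMonoid ℕ+) (a : ℕ+), w = u * FreeMonoid.of a := by
  rcases List.eq_nil_or_concat' w.toList with h | ⟨u, a, h⟩
  · exact Or.inl (FreeMonoid.toList.injective h)
  · exact Or.inr ⟨FreeMonoid.ofList u, a, FreeMonoid.toList.injective h⟩

theorem freeMonoid_induction_right {p : FreeMonoid ℕ+ → Prop} (one : p 1)
    (mul_of : ∀ w a, p w → p (w * FreeMonoid.of a)) (w : FreeMonoid ℕ+) : p w :=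
  List.reverseRecOn (motive := fun l => p (FreeMonoid.ofList l)) w.toList one
    fun l a hl => mul_of (FreeMonoid.ofList l) a hl

/-! ### The functionals dual to the elementary functions -/

open scoped Classical in
/-- The functional on `Λ'` with value `1` on `h_1 ^ k` and `0` on all other words. -/
def elemFun (R : Type*) [CommRing R] (k : ℕ) : FreeH R →ₗ[R] R :=
  (hBasis R).constr R fun w => if w = FreeMonoid.of 1 ^ k then 1 else 0

section elemFun

variable {R : Type*} [CommRing R]

open scoped Classical in
theorem elemFun_hWord (k : ℕ) (w : FreeMonoid ℕ+) :
    elemFun R k (hWord R w) = if w = FreeMonoid.of 1 ^ k then 1 else 0 := by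
  rw [elemFun, ← hBasis_apply, Module.Basis.constr_basis]

theorem weight_of_one_pow (k : ℕ) : weight (FreeMonoid.of 1 ^ k) = k := by
  induction k with
  | zero => simp [weight_one]
  | succ k ih => rw [pow_succ, weight_mul, ih, weight_of]; rfl

theorem mul_of_inj {u v : FreeMonoid ℕ+} {a b : ℕ+} :
    u * FreeMonoid.of a = v * FreeMonoid.of b ↔ u = v ∧ a = b := by
  constructor
  · intro h
    obtain ⟨h1, h2⟩ := List.append_inj' (congrArg FreeMonoid.toList h) rfl
    exact ⟨FreeMonoid.toList.injective h1, by simpa using h2⟩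
  · rintro ⟨rfl, rfl⟩
    rfl

theorem elemFun_zero_mul_h (w : FreeMonoid ℕ+) {l : ℕ} (hl : 0 < l) :
    elemFun R 0 (hWord R w * h R l) = 0 := by
  obtain ⟨a, rfl⟩ : ∃ b : ℕ+, (b : ℕ) = l := ⟨⟨l, hl⟩, rfl⟩
  rw [← hWord_of, ← hWord_mul, elemFun_hWord, pow_zero, if_neg]
  intro h
  have := congrArg weight h
  rw [weight_mul, weight_of, weight_one] at this
  have := a.pos
  omega

theorem elemFun_succ_mul_h_one (k : ℕ) (w : FreeMonoid ℕ+) :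
    elemFun R (k + 1) (hWord R w * h R 1) = elemFun R k (hWord R w) := by
  rw [show h R 1 = h R ((1 : ℕ+) : ℕ) from rfl, ← hWord_of, ← hWord_mul, elemFun_hWord,
    elemFun_hWord, pow_succ]
  congr 1
  rw [eq_iff_iff, mul_of_inj]
  exact and_iff_left rfl

theorem elemFun_mul_h (k : ℕ) (w : FreeMonoid ℕ+) {l : ℕ} (hl : 2 ≤ l) :
    elemFun R k (hWord R w * h R l) = 0 := by
  cases k with
  | zero => exact elemFun_zero_mul_h w (by omega)
  | succ k =>
    obtain ⟨a, rfl⟩ : ∃ b : ℕ+, (b : ℕ) = l := ⟨⟨l, by omega⟩, rfl⟩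
    rw [← hWord_of, ← hWord_mul, elemFun_hWord, pow_succ, if_neg]
    rw [mul_of_inj]
    rintro ⟨-, rfl⟩
    simp at hl

theorem elemFun_eq_zero (k : ℕ) (w : FreeMonoid ℕ+) (hw : weight w ≠ k) :
    elemFun R k (hWord R w) = 0 := by
  rw [elemFun_hWord, if_neg]
  rintro rfl
  exact hw (weight_of_one_pow k)

/-- The operator `(id ⊗ f_k) ∘ Δ`, where `f_k` is the functional `elemFun R k`. -/
def elemSkew (R : Type*) [CommRing R] (k : ℕ) : FreeH R →ₗ[R] FreeH R :=
  (TensorProduct.rid R (FreeH R)).toLinearMap ∘ₗ LinearMap.lTensor (FreeH R) (elemFun R k) ∘ₗ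
    freeComulLin R

theorem rid_lTensor_elemFun_superMul_zero (m : ℕ) (l : ℕ) (Y : FreeH R ⊗[R] FreeH R) :
    TensorProduct.rid R _ (LinearMap.lTensor _ (elemFun R 0)
      (superMul R Y (h R m ⊗ₜ h R l))) =
      if l = 0 then TensorProduct.rid R _ (LinearMap.lTensor _ (elemFun R 0) Y) * h R m else 0 := by
  refine LinearMap.congr_fun
    (f := (TensorProduct.rid R _).toLinearMap ∘ₗ LinearMap.lTensor _ (elemFun R 0) ∘ₗ
      (superMul R).flip (h R m ⊗ₜ h R l))
    (g := if l = 0 then LinearMap.mulRight R (h R m) ∘ₗ (TensorProduct.rid R _).toLinearMap ∘ₗ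
      LinearMap.lTensor _ (elemFun R 0) else 0)
    (linearMap_ext_hWord_tmul fun u v => ?_) Y |>.trans ?_
  · rw [LinearMap.comp_apply, LinearMap.comp_apply, LinearMap.flip_apply,
      superMul_tmul _ (hWord_mem R v) (h_mem R m)]
    rcases Nat.eq_zero_or_pos l with rfl | hl
    · by_cases hv : weight v = 0
      · simp [hv, h_zero]
      · simp [elemFun_eq_zero _ _ hv, h_zero]
    · simp [elemFun_zero_mul_h v hl, hl.ne']
  · split_ifs <;> simp

/-- The functional sees only words in `h_1`, so a last letter `h_l` in the second factor survives
only for `l = 0` or `l = 1`. It also fixes the degree of what precedes, which makes the Koszul sign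
explicit. -/
theorem rid_lTensor_elemFun_superMul_succ (k m : ℕ) (l : ℕ) (Y : FreeH R ⊗[R] FreeH R) :
    TensorProduct.rid R _ (LinearMap.lTensor _ (elemFun R (k + 1))
      (superMul R Y (h R m ⊗ₜ h R l))) =
      if l = 0 then (-1 : R) ^ ((k + 1) * m) •
        (TensorProduct.rid R _ (LinearMap.lTensor _ (elemFun R (k + 1)) Y) * h R m)
      else if l = 1 then (-1 : R) ^ (k * m) •
        (TensorProduct.rid R _ (LinearMap.lTensor _ (elemFun R k) Y) * h R m)
      else 0 := by
  refine LinearMap.congr_fun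
    (f := (TensorProduct.rid R _).toLinearMap ∘ₗ LinearMap.lTensor _ (elemFun R (k + 1)) ∘ₗ
      (superMul R).flip (h R m ⊗ₜ h R l))
    (g := if l = 0 then (-1 : R) ^ ((k + 1) * m) • (LinearMap.mulRight R (h R m) ∘ₗ
      (TensorProduct.rid R _).toLinearMap ∘ₗ LinearMap.lTensor _ (elemFun R (k + 1)))
      else if l = 1 then (-1 : R) ^ (k * m) • (LinearMap.mulRight R (h R m) ∘ₗ
      (TensorProduct.rid R _).toLinearMap ∘ₗ LinearMap.lTensor _ (elemFun R k)) else 0)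
    (linearMap_ext_hWord_tmul fun u v => ?_) Y |>.trans ?_
  · rw [LinearMap.comp_apply, LinearMap.comp_apply, LinearMap.flip_apply,
      superMul_tmul _ (hWord_mem R v) (h_mem R m)]
    rcases Nat.eq_zero_or_pos l with rfl | hl
    · by_cases hv : weight v = k + 1
      · simp [hv, h_zero]
      · simp [elemFun_eq_zero _ _ hv, h_zero]
    · rcases Nat.lt_or_ge 1 l with hl' | hl'
      · simp [elemFun_mul_h _ v hl', hl.ne', hl'.ne']
      · obtain rfl : l = 1 := by omega
        by_cases hv : weight v = k
        · simp [elemFun_succ_mul_h_one, hv]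
        · simp [elemFun_succ_mul_h_one, elemFun_eq_zero _ _ hv]
  · split_ifs <;> simp

theorem elemSkew_zero_mul_h (z : FreeH R) (a : ℕ) :
    elemSkew R 0 (z * h R a) = elemSkew R 0 z * h R a := by
  simp only [elemSkew, LinearMap.comp_apply, LinearEquiv.coe_coe]
  rw [freeComulLin_mul, freeComulLin_h]
  simp only [map_sum]
  simp_rw [rid_lTensor_elemFun_superMul_zero]
  rw [Finset.sum_range_succ, Finset.sum_eq_zero]
  · simp
  · intro m hm
    have := Finset.mem_range.1 hm
    rw [if_neg (by omega)]

/-- A twisted Leibniz rule: of `Δ h_{a+1}` only the terms `h_{a+1} ⊗ 1` and `h_a ⊗ h_1` matter, so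
the last letter loses at most one box. -/
theorem elemSkew_succ_mul_h (k : ℕ) (z : FreeH R) (a : ℕ) :
    elemSkew R (k + 1) (z * h R (a + 1)) =
      (-1 : R) ^ ((k + 1) * (a + 1)) • (elemSkew R (k + 1) z * h R (a + 1)) +
        (-1 : R) ^ (k * a) • (elemSkew R k z * h R a) := by
  simp only [elemSkew, LinearMap.comp_apply, LinearEquiv.coe_coe]
  rw [freeComulLin_mul, freeComulLin_h]
  simp only [map_sum]
  simp_rw [rid_lTensor_elemFun_superMul_succ]
  rw [Finset.sum_range_succ, Finset.sum_range_succ, Finset.sum_eq_zero, zero_add, add_comm]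
  · simp
  · intro m hm
    have := Finset.mem_range.1 hm
    rw [if_neg (by omega), if_neg (by omega)]

theorem elemSkew_one (k : ℕ) : elemSkew R k 1 = if k = 0 then 1 else 0 := by
  simp only [elemSkew, LinearMap.comp_apply, LinearEquiv.coe_coe, freeComulLin_one,
    LinearMap.lTensor_tmul, TensorProduct.rid_tmul]
  rw [← hWord_one, elemFun_hWord]
  cases k with
  | zero => simp
  | succ k =>
    rw [if_neg, if_neg (by omega), zero_smul]
    intro h
    have := congrArg weight h
    rw [weight_of_one_pow, weight_one] at this
    omega

theorem elemSkew_zero (z : FreeH R) : elemSkew R 0 z = z := by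
  refine LinearMap.congr_fun (f := elemSkew R 0) (g := LinearMap.id)
    (linearMap_ext_hWord fun w => ?_) z
  induction w using freeMonoid_induction_right with
  | one => rw [hWord_one, elemSkew_one]; simp
  | mul_of w a ih => rw [hWord_mul, hWord_of, elemSkew_zero_mul_h, ih]; rfl

end elemFun

/-! ### The elementary functions -/

/-- The sign `(-1) ^ (j (j + 1) / 2)`. -/
def elemSign (R : Type*) [CommRing R] : ℕ → R
  | 0 => 1
  | j + 1 => (-1) ^ (j + 1) * elemSign R j

theorem elemSign_mul_self (R : Type*) [CommRing R] (j : ℕ) : elemSign R j * elemSign R j = 1 := by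
  induction j with
  | zero => simp [elemSign]
  | succ j ih =>
    rw [elemSign, mul_mul_mul_comm, ih, ← pow_add, mul_one]
    exact Even.neg_one_pow ⟨_, rfl⟩

/-- The elementary functions `e_n ∈ Λ'`. -/
def elem (R : Type*) [CommRing R] : ℕ → FreeH R
  | 0 => 1
  | n + 1 => -(elemSign R (n + 1) • ∑ j : Fin (n + 1), elemSign R j • (h R (n + 1 - j) * elem R j))
decreasing_by exact j.2

theorem elem_relation (R : Type*) [CommRing R] (n : ℕ) :
    ∑ j ∈ Finset.range (n + 2), elemSign R j • (h R (n + 1 - j) * elem R j) = 0 := by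
  rw [Finset.sum_range_succ, Nat.sub_self, h_zero, one_mul, elem, smul_neg, smul_smul,
    elemSign_mul_self, one_smul, Finset.sum_range, add_neg_cancel]

section

variable {R : Type*} [CommRing R]

/-- The recursion defining `elem`, on the level of functionals. It is the inductive step for
`freeForm_elem`, with `Y` the coproduct of a word without its last letter `h_{a+1}`. -/
theorem elem_functional_superMul (n a : ℕ) (Y : FreeH R ⊗[R] FreeH R) :
    ∑ j ∈ Finset.range (n + 1), elemSign R j * tensorFun (freeForm R (h R (n - j))) (elemFun R j)
      (superMul R Y (freeComulLin R (h R (a + 1)))) = 0 := by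
  have key : (∑ j ∈ Finset.range (n + 1), elemSign R j •
      tensorFun (freeForm R (h R (n - j))) (elemFun R j)) ∘ₗ
      (superMul R).flip (freeComulLin R (h R (a + 1))) = 0 := by
    refine linearMap_ext_hWord_tmul fun u v => ?_
    have hterm : ∀ j m l, tensorFun (freeForm R (h R (n - j))) (elemFun R j)
        (superMul R (hWord R u ⊗ₜ hWord R v) (h R m ⊗ₜ h R l)) =
        if weight u + m = n - j then
          (-1) ^ (weight v * m) * elemFun R j (hWord R v * h R l) else 0 := by
      intro j m l
      rw [superMul_tmul _ (hWord_mem R v) (h_mem R m), map_smul, tensorFun_tmul]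
      rcases Nat.eq_zero_or_pos m with rfl | hm
      · rw [h_zero, mul_one, freeForm_h_hWord]
        simp
      · obtain ⟨b, rfl⟩ : ∃ b : ℕ+, (b : ℕ) = m := ⟨⟨m, hm⟩, rfl⟩
        rw [← hWord_of, ← hWord_mul, freeForm_h_hWord, weight_mul, weight_of]
        split_ifs <;> simp
    rw [LinearMap.comp_apply, LinearMap.flip_apply, freeComulLin_h, map_sum, map_sum,
      Finset.sum_range_succ, Finset.sum_range_succ, Finset.sum_eq_zero, zero_add,
      LinearMap.zero_apply, LinearMap.sum_apply, LinearMap.sum_apply]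
    · simp only [LinearMap.smul_apply, hterm, smul_eq_mul, Nat.sub_self,
        Nat.add_sub_cancel_left]
      simp only [h_zero, mul_one]
      by_cases hv : v = FreeMonoid.of 1 ^ weight v
      · have h1 : ∀ j, elemFun R j (hWord R v) = if j = weight v then 1 else 0 := by
          intro j
          by_cases hj : j = weight v
          · rw [if_pos hj, hj, elemFun_hWord, if_pos hv]
          · rw [if_neg hj, elemFun_eq_zero _ _ (Ne.symm hj)]
        have h2 : ∀ j, elemFun R j (hWord R v * h R 1) = if j = weight v + 1 then 1 else 0 := by
          intro j
          cases j with
          | zero => rw [elemFun_zero_mul_h _ Nat.one_pos, if_neg (by omega)]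
          | succ j => rw [elemFun_succ_mul_h_one, h1]; simp
        simp only [h1, h2]
        -- If `v` is `h_1^q`, the only contributions are `j = q` from `h_{a+1} ⊗ 1` and `j = q + 1`
        -- from `h_a ⊗ h_1`. They cancel because `elemSign` changes by `(-1)^(q+1)` from `q` to `q +
        -- 1`.
        by_cases hn : weight u + weight v + a + 1 = n
        · rw [Finset.sum_eq_single (weight v + 1), Finset.sum_eq_single (weight v)]
          · rw [if_pos (show weight u + a = n - (weight v + 1) by omega),
              if_pos (show weight u + (a + 1) = n - weight v by omega), if_pos rfl, if_pos rfl,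
              elemSign, mul_add,
              pow_add, pow_add]
            ring
          · intro j _ hj
            simp [hj]
          · intro h
            exact absurd (Finset.mem_range.2 (by omega)) h
          · intro j _ hj
            simp [hj]
          · intro h
            exact absurd (Finset.mem_range.2 (by omega)) h
        · rw [Finset.sum_eq_zero, Finset.sum_eq_zero, add_zero]
          · intro j hj
            have := Finset.mem_range.1 hj
            by_cases hj' : j = weight v
            · rw [if_neg (by omega), mul_zero]
            · simp [hj']
          · intro j hj
            have := Finset.mem_range.1 hj
            by_cases hj' : j = weight v + 1
            · rw [if_neg (by omega), mul_zero]
            · simp [hj']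
      · have h1 : ∀ j, elemFun R j (hWord R v) = 0 := by
          intro j
          rw [elemFun_hWord, if_neg]
          intro h
          apply hv
          rw [h, weight_of_one_pow]
        have h2 : ∀ j, elemFun R j (hWord R v * h R 1) = 0 := by
          intro j
          cases j with
          | zero => exact elemFun_zero_mul_h _ Nat.one_pos
          | succ j => rw [elemFun_succ_mul_h_one, h1]
        simp [h1, h2]
    · intro m hm
      have := Finset.mem_range.1 hm
      rw [LinearMap.sum_apply]
      refine Finset.sum_eq_zero fun j _ => ?_
      rw [LinearMap.smul_apply, hterm, elemFun_mul_h _ _ (by omega)]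
      simp
  have := LinearMap.congr_fun key Y
  rw [LinearMap.comp_apply, LinearMap.sum_apply] at this
  exact this

/-- Pairing with `1` is the counit of `Δ`. -/
theorem tensorFun_freeForm_one (ψ : FreeH R →ₗ[R] R) (z : FreeH R) :
    tensorFun (freeForm R 1) ψ (freeComulLin R z) = ψ z := by
  have key : ∀ (m l : ℕ) (Y : FreeH R ⊗[R] FreeH R),
      TensorProduct.lid R _ (LinearMap.rTensor _ (freeForm R 1)
        (superMul R Y (h R m ⊗ₜ h R l))) =
      if m = 0 then TensorProduct.lid R _ (LinearMap.rTensor _ (freeForm R 1) Y) * h R l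
        else 0 := by
    intro m l Y
    refine LinearMap.congr_fun
      (f := (TensorProduct.lid R _).toLinearMap ∘ₗ LinearMap.rTensor _ (freeForm R 1) ∘ₗ
        (superMul R).flip (h R m ⊗ₜ h R l))
      (g := if m = 0 then LinearMap.mulRight R (h R l) ∘ₗ (TensorProduct.lid R _).toLinearMap ∘ₗ
        LinearMap.rTensor _ (freeForm R 1) else 0)
      (linearMap_ext_hWord_tmul fun u v => ?_) Y |>.trans ?_
    · rw [LinearMap.comp_apply, LinearMap.comp_apply, LinearMap.flip_apply,
        superMul_tmul _ (hWord_mem R v) (h_mem R m)]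
      rcases Nat.eq_zero_or_pos m with rfl | hm
      · simp [h_zero]
      · have : freeForm R 1 (hWord R u * h R m) = 0 :=
          freeForm_eq_zero_of_mem (i := 0) (j := weight u + m) (by omega)
            SetLike.GradedOne.one_mem (SetLike.GradedMul.mul_mem (hWord_mem R u) (h_mem R m))
        simp [this, hm.ne']
    · split_ifs <;> simp
  have key' : (TensorProduct.lid R _).toLinearMap ∘ₗ LinearMap.rTensor _ (freeForm R 1) ∘ₗ
      freeComulLin R = LinearMap.id := by
    refine linearMap_ext_hWord fun w => ?_
    induction w using freeMonoid_induction_right with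
    | one =>
      have : freeForm R 1 1 = 1 := by
        have := freeForm_h_hWord R 0 1
        rwa [h_zero, hWord_one, weight_one, if_pos rfl] at this
      simp [hWord_one, freeComulLin_one, this]
    | mul_of w a ih =>
      rw [LinearMap.comp_apply, LinearMap.comp_apply] at ih ⊢
      rw [hWord_mul, hWord_of, freeComulLin_mul, freeComulLin_h]
      simp only [map_sum, LinearEquiv.coe_coe, key]
      rw [Finset.sum_range_succ', Finset.sum_eq_zero (by simp), if_pos rfl]
      erw [ih]
      simp
  have h1 : tensorFun (freeForm R 1) ψ = ψ ∘ₗ (TensorProduct.lid R _).toLinearMap ∘ₗ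
      LinearMap.rTensor _ (freeForm R 1) := by
    refine linearMap_ext_hWord_tmul fun u v => ?_
    simp [tensorFun_tmul]
  rw [h1]
  exact congrArg ψ (LinearMap.congr_fun key' z)

theorem freeForm_elem (n : ℕ) : freeForm R (elem R n) = elemFun R n := by
  induction n using Nat.strong_induction_on with
  | _ n ih =>
    cases n with
    | zero =>
      refine linearMap_ext_hWord fun w => ?_
      rw [elem, ← h_zero R, freeForm_h_hWord, elemFun_hWord, pow_zero]
      congr 1
      rw [eq_iff_iff]
      constructor
      · intro h
        rcases eq_one_or_eq_mul_of w with rfl | ⟨u, a, rfl⟩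
        · rfl
        · rw [weight_mul, weight_of] at h
          have := a.pos
          omega
      · rintro rfl
        exact weight_one
    | succ n =>
      refine linearMap_ext_hWord fun w => ?_
      have h0 : ∑ j ∈ Finset.range (n + 2), elemSign R j *
          tensorFun (freeForm R (h R (n + 1 - j))) (elemFun R j)
            (freeComulLin R (hWord R w)) = 0 := by
        rcases eq_one_or_eq_mul_of w with rfl | ⟨u, a, rfl⟩
        · refine Finset.sum_eq_zero fun j hj => ?_
          rw [hWord_one, freeComulLin_one, tensorFun_tmul, ← hWord_one, freeForm_h_hWord,
            weight_one]
          split_ifs with h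
          · rw [elemFun_eq_zero, mul_zero, mul_zero]
            rw [weight_one]
            omega
          · simp
        · have := elem_functional_superMul (n + 1) (a - 1) (freeComulLin R (hWord R u))
          rw [Nat.sub_add_cancel a.pos, ← freeComulLin_mul, ← hWord_of, ← hWord_mul] at this
          exact this
      rw [Finset.sum_range_succ, Nat.sub_self, h_zero, tensorFun_freeForm_one,
        Finset.sum_range] at h0
      have h1 : ∀ j : Fin (n + 1), freeForm R (h R (n + 1 - j) * elem R j) (hWord R w) =
          tensorFun (freeForm R (h R (n + 1 - j))) (elemFun R j)
            (freeComulLin R (hWord R w)) := fun j => by rw [freeForm_mul, ih j (by omega)]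
      rw [elem]
      simp only [map_neg, map_smul, map_sum, LinearMap.neg_apply, LinearMap.smul_apply,
        LinearMap.sum_apply, h1, smul_eq_mul]
      rw [eq_neg_of_add_eq_zero_left h0, mul_neg, ← mul_assoc, elemSign_mul_self, one_mul, neg_neg]

theorem freeForm_mul_elem (x z : FreeH R) (k : ℕ) :
    freeForm R (x * elem R k) z = freeForm R x (elemSkew R k z) := by
  rw [freeForm_mul, freeForm_elem]
  have : tensorFun (freeForm R x) (elemFun R k) = freeForm R x ∘ₗ
      (TensorProduct.rid R (FreeH R)).toLinearMap ∘ₗ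
        LinearMap.lTensor (FreeH R) (elemFun R k) := by
    refine linearMap_ext_hWord_tmul fun u v => ?_
    simp [tensorFun_tmul, mul_comm]
  rw [this]
  rfl

theorem elemSkew_mem_radical {z : FreeH R} (hz : z ∈ radical R) (k : ℕ) :
    elemSkew R k z ∈ radical R := by
  rw [mem_radical_iff]
  intro w
  rw [← freeForm_mul_elem, freeForm_eq_zero hz]

/-- The relation between the `h` and the `e` writes `h_a` as a combination of terms `h_{a-j} e_j`
with `j ≥ 1`. Every nonempty word therefore lies in the sum of the left ideals generated by these
`e_j`, and pairing `z` with it only involves the skewings of `z`. -/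
theorem mem_radical_of_elemSkew {z : FreeH R} (h1 : freeForm R 1 z = 0)
    (hz : ∀ k, elemSkew R (k + 1) z ∈ radical R) : z ∈ radical R := by
  rw [mem_radical_iff]
  intro w
  rcases eq_one_or_eq_mul_of w with rfl | ⟨u, a, rfl⟩
  · rw [hWord_one, h1]
  · have := elem_relation R (a - 1)
    rw [show (a : ℕ) - 1 + 2 = a + 1 by have := a.pos; omega, Nat.sub_add_cancel a.pos,
      Finset.sum_range_succ', elem, elemSign, one_smul, mul_one, Nat.sub_zero] at this
    rw [hWord_mul, hWord_of, eq_neg_of_add_eq_zero_right this, mul_neg, map_neg, Finset.mul_sum,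
      map_sum, LinearMap.neg_apply, LinearMap.sum_apply, Finset.sum_eq_zero, neg_zero]
    intro j _
    rw [mul_smul_comm, map_smul, LinearMap.smul_apply, ← mul_assoc, freeForm_mul_elem,
      freeForm_eq_zero (hz j), smul_zero]

end

/-! ### The defining relations of `Λ` -/

/-- The elements `h_n` indexed by all integers, with `h_n = 0` for `n < 0`. -/
def hInt (R : Type*) [CommRing R] (n : ℤ) : FreeH R := if 0 ≤ n then h R n.toNat else 0

section

variable {R : Type*} [CommRing R]

theorem hInt_natCast (n : ℕ) : hInt R n = h R n := by simp [hInt]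

theorem hInt_of_neg {n : ℤ} (hn : n < 0) : hInt R n = 0 := if_neg hn.not_ge

theorem elemSkew_succ_mul_hInt (k : ℕ) (z : FreeH R) (n : ℤ) :
    elemSkew R (k + 1) (z * hInt R n) =
      (-1 : R) ^ ((k + 1) * n.natAbs) • (elemSkew R (k + 1) z * hInt R n) +
        (-1 : R) ^ (k * (n - 1).natAbs) • (elemSkew R k z * hInt R (n - 1)) := by
  rcases lt_or_ge n 0 with hn | hn
  · rw [hInt_of_neg hn, hInt_of_neg (show n - 1 < 0 by omega)]
    simp
  · obtain ⟨a, rfl⟩ := Int.eq_ofNat_of_zero_le hn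
    cases a with
    | zero =>
      rw [hInt_natCast, hInt_of_neg (show ((0 : ℕ) : ℤ) - 1 < 0 by omega), h_zero]
      simp
    | succ a =>
      rw [show ((a + 1 : ℕ) : ℤ) - 1 = (a : ℕ) by omega, hInt_natCast, hInt_natCast,
        elemSkew_succ_mul_h, Int.natAbs_natCast, Int.natAbs_natCast]

theorem elemSkew_one_hInt (n : ℤ) : elemSkew R 1 (hInt R n) = hInt R (n - 1) := by
  have := elemSkew_succ_mul_hInt 0 (1 : FreeH R) n
  rw [one_mul, elemSkew_zero, zero_add, elemSkew_one] at this
  simpa using this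

theorem elemSkew_add_two_hInt (k : ℕ) (n : ℤ) : elemSkew R (k + 2) (hInt R n) = 0 := by
  have := elemSkew_succ_mul_hInt (k + 1) (1 : FreeH R) n
  rw [one_mul, elemSkew_one, elemSkew_one] at this
  simpa using this

theorem elemSkew_one_hInt_mul_of_even (m : ℤ) {n : ℤ} (hn : Even n) :
    elemSkew R 1 (hInt R m * hInt R n) =
      hInt R (m - 1) * hInt R n + hInt R m * hInt R (n - 1) := by
  rw [← zero_add 1, elemSkew_succ_mul_hInt, zero_add, elemSkew_one_hInt, elemSkew_zero, one_mul,
    (Int.natAbs_even.2 hn).neg_one_pow]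
  simp

theorem elemSkew_one_hInt_mul_of_odd (m : ℤ) {n : ℤ} (hn : Odd n) :
    elemSkew R 1 (hInt R m * hInt R n) =
      -(hInt R (m - 1) * hInt R n) + hInt R m * hInt R (n - 1) := by
  rw [← zero_add 1, elemSkew_succ_mul_hInt, zero_add, elemSkew_one_hInt, elemSkew_zero, one_mul,
    (Int.natAbs_odd.2 hn).neg_one_pow]
  simp

theorem elemSkew_two_hInt_mul_of_even (m : ℤ) {n : ℤ} (hn : Even n) :
    elemSkew R 2 (hInt R m * hInt R n) = -(hInt R (m - 1) * hInt R (n - 1)) := by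
  rw [← one_add_one_eq_two, elemSkew_succ_mul_hInt, elemSkew_one_hInt, elemSkew_add_two_hInt 0,
    one_mul, (Int.natAbs_odd.2 (hn.sub_odd odd_one)).neg_one_pow]
  simp

theorem elemSkew_two_hInt_mul_of_odd (m : ℤ) {n : ℤ} (hn : Odd n) :
    elemSkew R 2 (hInt R m * hInt R n) = hInt R (m - 1) * hInt R (n - 1) := by
  rw [← one_add_one_eq_two, elemSkew_succ_mul_hInt, elemSkew_one_hInt, elemSkew_add_two_hInt 0,
    one_mul, (Int.natAbs_even.2 (hn.sub_odd odd_one)).neg_one_pow]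
  simp

theorem elemSkew_add_three_hInt_mul (k : ℕ) (m n : ℤ) :
    elemSkew R (k + 3) (hInt R m * hInt R n) = 0 := by
  rw [elemSkew_succ_mul_hInt, elemSkew_add_two_hInt (k + 1), elemSkew_add_two_hInt k]
  simp

theorem hInt_mul_hInt_of_neg {m n : ℤ} (hmn : m + n < 0) : hInt R m * hInt R n = 0 := by
  rcases lt_or_ge m 0 with hm | hm
  · rw [hInt_of_neg hm, zero_mul]
  · rw [hInt_of_neg (show n < 0 by omega), mul_zero]

theorem freeForm_one_hInt_mul {m n : ℤ} (hmn : m ≠ 0 ∨ n ≠ 0) :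
    freeForm R 1 (hInt R m * hInt R n) = 0 := by
  rcases lt_or_ge m 0 with hm | hm
  · rw [hInt_of_neg hm, zero_mul, map_zero]
  rcases lt_or_ge n 0 with hn | hn
  · rw [hInt_of_neg hn, mul_zero, map_zero]
  obtain ⟨a, rfl⟩ := Int.eq_ofNat_of_zero_le hm
  obtain ⟨b, rfl⟩ := Int.eq_ofNat_of_zero_le hn
  rw [hInt_natCast, hInt_natCast]
  exact freeForm_eq_zero_of_mem (i := 0) (j := a + b) (by omega) SetLike.GradedOne.one_mem
    (SetLike.GradedMul.mul_mem (h_mem R a) (h_mem R b))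

theorem mem_radical_of_elemSkew_le_two {z : FreeH R} (h1 : freeForm R 1 z = 0)
    (hz1 : elemSkew R 1 z ∈ radical R) (hz2 : elemSkew R 2 z ∈ radical R)
    (hz3 : ∀ k, elemSkew R (k + 3) z = 0) : z ∈ radical R := by
  refine mem_radical_of_elemSkew h1 fun k => ?_
  rcases k with _ | _ | k
  · exact hz1
  · exact hz2
  · rw [show k + 1 + 1 + 1 = k + 3 from rfl, hz3]
    exact zero_mem _

/-- The four families are closed under skewing: up to sign, `elemSkew 1` and `elemSkew 2` send each
relation to a relation, or to a sum of two relations, of smaller total degree, and higher skewings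
kill products of two letters. Integer indices, with `h_n = 0` for `n < 0`, remove the boundary cases
from the induction. -/
theorem hInt_relations (M : ℕ) : ∀ m n : ℤ, m + n < M →
    (Even m → Even n → hInt R m * hInt R n - hInt R n * hInt R m ∈ radical R) ∧
    (Odd m → Odd n → hInt R m * hInt R n - hInt R n * hInt R m ∈ radical R) ∧
    (Even m → Odd n → hInt R m * hInt R n + hInt R n * hInt R m -
      hInt R (m + 1) * hInt R (n - 1) - hInt R (n - 1) * hInt R (m + 1) ∈ radical R) ∧
    (Odd m → Even n → hInt R m * hInt R n - hInt R n * hInt R m +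
      hInt R (m + 1) * hInt R (n - 1) - hInt R (n - 1) * hInt R (m + 1) ∈ radical R) := by
  induction M with
  | zero =>
    intro m n hmn
    -- With negative total degree every product has a factor of negative index.
    rw [hInt_mul_hInt_of_neg hmn, hInt_mul_hInt_of_neg (show n + m < 0 by push_cast at hmn; omega),
      hInt_mul_hInt_of_neg (show m + 1 + (n - 1) < 0 by push_cast at hmn; omega),
      hInt_mul_hInt_of_neg (show n - 1 + (m + 1) < 0 by push_cast at hmn; omega)]
    simp
  | succ M ih =>
    intro m n hmn
    push_cast at hmn
    have ih1 := fun m' n' (h' : m' + n' = m + n - 1) => ih m' n' (by omega)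
    have ih2 := fun m' n' (h' : m' + n' = m + n - 2) => ih m' n' (by omega)
    refine ⟨fun hm hn => ?_, fun hm hn => ?_, fun hm hn => ?_, fun hm hn => ?_⟩
    -- In degree zero the pairing with `1` need not vanish, so this case is separate.
    · by_cases h0 : m = 0 ∧ n = 0
      · rw [h0.1, h0.2, sub_self]
        exact zero_mem _
      refine mem_radical_of_elemSkew_le_two ?_ ?_ ?_ fun k => ?_
      · rw [map_sub, freeForm_one_hInt_mul (by omega), freeForm_one_hInt_mul (by omega), sub_zero]
      · have := (ih1 (m - 1) n (by omega)).2.2.2 (hm.sub_odd odd_one) hn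
        rw [sub_add_cancel] at this
        rw [map_sub, elemSkew_one_hInt_mul_of_even _ hn, elemSkew_one_hInt_mul_of_even _ hm]
        convert this using 1
        abel
      · have := (ih2 (m - 1) (n - 1) (by omega)).2.1 (hm.sub_odd odd_one) (hn.sub_odd odd_one)
        rw [map_sub, elemSkew_two_hInt_mul_of_even _ hn, elemSkew_two_hInt_mul_of_even _ hm]
        convert neg_mem this using 1
        abel
      · rw [map_sub, elemSkew_add_three_hInt_mul, elemSkew_add_three_hInt_mul, sub_zero]
    · refine mem_radical_of_elemSkew_le_two ?_ ?_ ?_ fun k => ?_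
      · have : m ≠ 0 := by rintro rfl; simp at hm
        rw [map_sub, freeForm_one_hInt_mul (by omega), freeForm_one_hInt_mul (by omega), sub_zero]
      · have := (ih1 (m - 1) n (by omega)).2.2.1 (hm.sub_odd odd_one) hn
        rw [sub_add_cancel] at this
        rw [map_sub, elemSkew_one_hInt_mul_of_odd _ hn, elemSkew_one_hInt_mul_of_odd _ hm]
        convert neg_mem this using 1
        abel
      · have := (ih2 (m - 1) (n - 1) (by omega)).1 (hm.sub_odd odd_one) (hn.sub_odd odd_one)
        rw [map_sub, elemSkew_two_hInt_mul_of_odd _ hn, elemSkew_two_hInt_mul_of_odd _ hm]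
        exact this
      · rw [map_sub, elemSkew_add_three_hInt_mul, elemSkew_add_three_hInt_mul, sub_zero]
    · refine mem_radical_of_elemSkew_le_two ?_ ?_ ?_ fun k => ?_
      · have : m + n ≠ 0 := by intro h; have := hm.add_odd hn; rw [h] at this; simp at this
        rw [map_sub, map_sub, map_add, freeForm_one_hInt_mul (by omega),
          freeForm_one_hInt_mul (by omega), freeForm_one_hInt_mul (by omega),
          freeForm_one_hInt_mul (by omega)]
        simp
      · have e1 := (ih1 (m - 1) n (by omega)).2.1 (hm.sub_odd odd_one) hn
        have e2 := (ih1 (m + 1) (n - 2) (by omega)).2.1 (hm.add_odd odd_one)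
          (hn.sub_even even_two)
        rw [map_sub, map_sub, map_add, elemSkew_one_hInt_mul_of_odd _ hn,
          elemSkew_one_hInt_mul_of_even _ hm, elemSkew_one_hInt_mul_of_even _ (hn.sub_odd odd_one),
          elemSkew_one_hInt_mul_of_odd _ (hm.add_odd odd_one), add_sub_cancel_right,
          show n - 1 - 1 = n - 2 by ring]
        convert neg_mem (add_mem e1 e2) using 1
        abel
      · have := (ih2 (m - 1) (n - 1) (by omega)).2.2.2 (hm.sub_odd odd_one) (hn.sub_odd odd_one)
        rw [sub_add_cancel, show n - 1 - 1 = n - 2 by ring] at this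
        rw [map_sub, map_sub, map_add, elemSkew_two_hInt_mul_of_odd _ hn,
          elemSkew_two_hInt_mul_of_even _ hm, elemSkew_two_hInt_mul_of_even _ (hn.sub_odd odd_one),
          elemSkew_two_hInt_mul_of_odd _ (hm.add_odd odd_one), add_sub_cancel_right,
          show n - 1 - 1 = n - 2 by ring]
        convert this using 1
        abel
      · simp only [map_sub, map_add, elemSkew_add_three_hInt_mul, sub_zero, add_zero]
    · refine mem_radical_of_elemSkew_le_two ?_ ?_ ?_ fun k => ?_
      · have : m + n ≠ 0 := by intro h; have := hm.add_even hn; rw [h] at this; simp at this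
        rw [map_sub, map_add, map_sub, freeForm_one_hInt_mul (by omega),
          freeForm_one_hInt_mul (by omega), freeForm_one_hInt_mul (by omega),
          freeForm_one_hInt_mul (by omega)]
        simp
      · have e1 := (ih1 (m - 1) n (by omega)).1 (hm.sub_odd odd_one) hn
        have e2 := (ih1 (m + 1) (n - 2) (by omega)).1 (hm.add_odd odd_one)
          (hn.sub even_two)
        rw [map_sub, map_add, map_sub, elemSkew_one_hInt_mul_of_even _ hn,
          elemSkew_one_hInt_mul_of_odd _ hm, elemSkew_one_hInt_mul_of_odd _ (hn.sub_odd odd_one),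
          elemSkew_one_hInt_mul_of_even _ (hm.add_odd odd_one), add_sub_cancel_right,
          show n - 1 - 1 = n - 2 by ring]
        convert add_mem e1 e2 using 1
        abel
      · have := (ih2 (m - 1) (n - 1) (by omega)).2.2.1 (hm.sub_odd odd_one) (hn.sub_odd odd_one)
        rw [sub_add_cancel, show n - 1 - 1 = n - 2 by ring] at this
        rw [map_sub, map_add, map_sub, elemSkew_two_hInt_mul_of_even _ hn,
          elemSkew_two_hInt_mul_of_odd _ hm, elemSkew_two_hInt_mul_of_odd _ (hn.sub_odd odd_one),
          elemSkew_two_hInt_mul_of_even _ (hm.add_odd odd_one), add_sub_cancel_right,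
          show n - 1 - 1 = n - 2 by ring]
        convert neg_mem this using 1
        abel
      · simp only [map_sub, map_add, elemSkew_add_three_hInt_mul, sub_zero, add_zero]

theorem h_mul_h_sub_mem_radical {m n : ℕ} (hmn : Even (m + n)) :
    h R m * h R n - h R n * h R m ∈ radical R := by
  have := hInt_relations (R := R) (m + n + 1) m n (by push_cast; omega)
  rw [hInt_natCast, hInt_natCast] at this
  rcases Nat.even_or_odd m with hm | hm
  · exact this.1 (by exact_mod_cast hm) (by exact_mod_cast (Nat.even_add.1 hmn).1 hm)
  · refine this.2.1 (by exact_mod_cast hm) ?_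
    rw [Nat.even_add] at hmn
    rw [← Nat.not_even_iff_odd] at hm
    exact_mod_cast Nat.not_even_iff_odd.1 (fun h' => hm (hmn.2 h'))

theorem h_relation_even_odd {m n : ℕ} (hm : Even m) (hn : Even n) :
    h R m * h R (n + 1) + h R (n + 1) * h R m - h R (m + 1) * h R n - h R n * h R (m + 1) ∈
      radical R := by
  have := (hInt_relations (R := R) (m + (n + 1) + 1) m (n + 1 : ℕ) (by push_cast; omega)).2.2.1
    (by exact_mod_cast hm) (by exact_mod_cast hn.add_one)
  rw [show ((n + 1 : ℕ) : ℤ) - 1 = n by push_cast; ring,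
    show (m : ℤ) + 1 = (m + 1 : ℕ) by push_cast; ring] at this
  simpa only [hInt_natCast] using this

theorem h_relation_odd_even {m n : ℕ} (hm : Odd m) (hn : Odd n) :
    h R m * h R (n + 1) - h R (n + 1) * h R m + h R (m + 1) * h R n - h R n * h R (m + 1) ∈
      radical R := by
  have := (hInt_relations (R := R) (m + (n + 1) + 1) m (n + 1 : ℕ) (by push_cast; omega)).2.2.2
    (by exact_mod_cast hm) (by exact_mod_cast hn.add_one)
  rw [show ((n + 1 : ℕ) : ℤ) - 1 = n by push_cast; ring,
    show (m : ℤ) + 1 = (m + 1 : ℕ) by push_cast; ring] at this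
  simpa only [hInt_natCast] using this

end

/-! ### Spanning by decreasing words -/

/-- The product `h_{a_1} ⋯ h_{a_r}` for a list of natural numbers. -/
def hList (R : Type*) [CommRing R] (l : List ℕ) : FreeH R := (l.map (h R)).prod

/-- The sum of the entries of a list weighted by their positions. -/
def posSum : List ℕ → ℕ
  | [] => 0
  | _ :: l => posSum l + l.sum

/-- Replacing `m, n` by `a, b` with the same sum changes `posSum` by `b - n`, so straightening,
where `b < n`, lowers it. -/
theorem posSum_append (u v : List ℕ) {m n a b : ℕ} (hab : a + b = m + n) :
    posSum (u ++ a :: b :: v) + n = posSum (u ++ m :: n :: v) + b := by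
  induction u with
  | nil => simp only [List.nil_append, posSum, List.sum_cons]; omega
  | cons c u ih =>
    simp only [List.cons_append, posSum, List.sum_append, List.sum_cons] at ih ⊢
    omega

theorem exists_ascent {l : List ℕ} (hl : ¬ l.Pairwise (· ≥ ·)) :
    ∃ u m n v, l = u ++ m :: n :: v ∧ m < n := by
  induction l with
  | nil => simp at hl
  | cons a l ih =>
    by_cases h : l.Pairwise (· ≥ ·)
    · cases l with
      | nil => simp at hl
      | cons b l =>
        refine ⟨[], a, b, l, rfl, ?_⟩
        by_contra hab
        apply hl
        rw [← List.isChain_iff_pairwise] at h ⊢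
        exact List.IsChain.cons_cons (not_lt.1 hab) h
    · obtain ⟨u, m, n, v, rfl, hmn⟩ := ih h
      exact ⟨a :: u, m, n, v, rfl, hmn⟩

section

variable {R : Type*} [CommRing R]

theorem hList_append (u v : List ℕ) : hList R (u ++ v) = hList R u * hList R v := by
  simp [hList]

theorem hList_cons (a : ℕ) (v : List ℕ) : hList R (a :: v) = h R a * hList R v := by
  simp [hList]

theorem hList_nil : hList R [] = 1 := by
  simp [hList]

theorem hList_mem (l : List ℕ) : hList R l ∈ grading R l.sum := by
  induction l with
  | nil => exact SetLike.GradedOne.one_mem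
  | cons a l ih =>
    rw [hList_cons, List.sum_cons]
    exact SetLike.GradedMul.mul_mem (h_mem R a) ih

theorem hWord_eq_hList (w : FreeMonoid ℕ+) :
    hWord R w = hList R (w.toList.map (fun a : ℕ+ => (a : ℕ))) := by
  induction w using FreeMonoid.inductionOn' with
  | one => simp [hWord_one, hList_nil]
  | of_mul a w ih => rw [hWord_mul, hWord_of, ih]; simp [hList_cons]

/-- The two-letter words which occur in the straightened form of `h_m h_n`. -/
def straightPairs (R : Type*) [CommRing R] (m n : ℕ) : Submodule R (FreeH R) :=
  radical R ⊔ Submodule.span R {x | ∃ a b, n ≤ a ∧ a + b = m + n ∧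
    (b = 0 → m = 0 ∨ Odd (m + n)) ∧ x = h R a * h R b}

/-- For even degree the two letters commute. For odd degree the four-term relation trades `h_{m+1}
h_n` for `h_m h_{n+1}`, which is further from being decreasing but has a smaller first index, plus
decreasing products. Only in odd degree can a letter degenerate to `h_0`. -/
theorem h_mul_h_mem_straightPairs {m n : ℕ} (hmn : m < n) :
    h R m * h R n ∈ straightPairs R m n := by
  induction m using Nat.strong_induction_on generalizing n with
  | _ m ih =>
    have base : ∀ a b, n ≤ a → a + b = m + n → (b = 0 → m = 0 ∨ Odd (m + n)) →
        h R a * h R b ∈ straightPairs R m n := fun a b h1 h2 h3 =>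
      Submodule.mem_sup_right (Submodule.subset_span ⟨a, b, h1, h2, h3, rfl⟩)
    have hrad : radical R ≤ straightPairs R m n := le_sup_left
    have hnm : h R n * h R m ∈ straightPairs R m n :=
      base n m le_rfl (add_comm _ _) fun h => Or.inl h
    rcases Nat.even_or_odd (m + n) with he | ho
    · have := add_mem (hrad (h_mul_h_sub_mem_radical he)) hnm
      rwa [sub_add_cancel] at this
    · rcases m with _ | m
      · rw [h_zero, one_mul]
        simpa [h_zero] using hnm
      have h1 : h R m * h R (n + 1) ∈ straightPairs R (m + 1) n := by
        have hle : straightPairs R m (n + 1) ≤ straightPairs R (m + 1) n := by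
          refine sup_le_sup_left (Submodule.span_mono ?_) _
          rintro _ ⟨a, b, h1, h2, h3, rfl⟩
          exact ⟨a, b, by omega, by omega, fun _ => Or.inr ho, rfl⟩
        exact hle (ih m (by omega) (by omega))
      have h2 : h R (n + 1) * h R m ∈ straightPairs R (m + 1) n :=
        base (n + 1) m (by omega) (by omega) fun _ => Or.inr ho
      rcases Nat.even_or_odd m with hm | hm
      · have hn : Even n := by
          by_contra hn
          rw [Nat.not_even_iff_odd] at hn
          exact absurd (hm.add_one.add_odd hn) (Nat.not_even_iff_odd.2 ho)
        have := hrad (h_relation_even_odd (R := R) hm hn)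
        have := sub_mem (sub_mem (add_mem h1 h2) this) hnm
        convert this using 1
        abel
      · have hn : Odd n := by
          by_contra hn
          rw [Nat.not_odd_iff_even] at hn
          exact absurd (hm.add_one.add hn) (Nat.not_even_iff_odd.2 ho)
        have := hrad (h_relation_odd_even (R := R) hm hn)
        have := add_mem (sub_mem this (sub_mem h1 h2)) hnm
        convert this using 1
        abel

/-- The property of a list of having odd sum or at least two nonzero entries. -/
def OddOrLong (l : List ℕ) : Prop := Odd l.sum ∨ 2 ≤ l.countP (0 < ·)

/-- The words with decreasing exponents which occur in the straightened form of a word. -/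
def straightWords (R : Type*) [CommRing R] (w : List ℕ) : Submodule R (FreeH R) :=
  radical R ⊔ Submodule.span R {x | ∃ l : List ℕ, l.Pairwise (· ≥ ·) ∧ l.sum = w.sum ∧
    (OddOrLong w → OddOrLong l) ∧ x = hList R l}

theorem oddOrLong_append (u v : List ℕ) {m n a b : ℕ} (hmn : m < n) (hna : n ≤ a)
    (hab : a + b = m + n) (hb : b = 0 → m = 0 ∨ Odd (m + n))
    (hw : OddOrLong (u ++ m :: n :: v)) : OddOrLong (u ++ a :: b :: v) := by
  unfold OddOrLong at *
  simp only [List.sum_append, List.sum_cons, List.countP_append, List.countP_cons,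
    decide_eq_true_eq] at *
  have hsum : u.sum + (a + (b + v.sum)) = u.sum + (m + (n + v.sum)) := by omega
  rw [hsum]
  rcases Nat.even_or_odd (u.sum + (m + (n + v.sum))) with he | ho
  · refine Or.inr ?_
    have hw := hw.resolve_left (Nat.not_odd_iff_even.2 he)
    rw [if_pos (show 0 < n by omega)] at hw
    rw [if_pos (show 0 < a by omega)]
    rcases Nat.eq_zero_or_pos b with rfl | hb'
    -- A letter is lost only if the pair has odd degree. As the whole word has even degree, the rest
    -- of it has odd degree and still contains a nonzero entry.
    · rcases hb rfl with rfl | ho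
      · simpa using hw
      · have hpos : ∀ l : List ℕ, l.sum ≠ 0 → 1 ≤ l.countP (0 < ·) := by
          intro l hl
          rw [Nat.one_le_iff_ne_zero, Ne, List.countP_eq_zero]
          intro h
          apply hl
          rw [List.sum_eq_zero_iff]
          simpa using h
        have hne : u.sum ≠ 0 ∨ v.sum ≠ 0 := by
          by_contra hne
          push Not at hne
          rw [hne.1, hne.2, zero_add, add_zero] at he
          exact absurd he (Nat.not_even_iff_odd.2 ho)
        rcases hne with h | h
        · have := hpos u h
          omega
        · have := hpos v h
          omega
    · rw [if_pos hb']
      omega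
  · exact Or.inl ho

theorem hList_mem_straightWords (w : List ℕ) : hList R w ∈ straightWords R w := by
  induction hN : posSum w using Nat.strong_induction_on generalizing w with
  | _ N ih =>
    by_cases hw : w.Pairwise (· ≥ ·)
    · exact Submodule.mem_sup_right (Submodule.subset_span ⟨w, hw, rfl, id, rfl⟩)
    · obtain ⟨u, m, n, v, rfl, hmn⟩ := exists_ascent hw
      let F : FreeH R →ₗ[R] FreeH R :=
        LinearMap.mulLeft R (hList R u) ∘ₗ LinearMap.mulRight R (hList R v)
      have hF : ∀ a b, F (h R a * h R b) = hList R (u ++ a :: b :: v) := by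
        intro a b
        simp [F, hList_append, hList_cons, mul_assoc]
      have hle : straightPairs R m n ≤
          (straightWords R (u ++ m :: n :: v)).comap F := by
        refine sup_le (fun x hx => ?_) (Submodule.span_le.2 ?_)
        · exact Submodule.mem_sup_left (mul_mem_radical_left _ (mul_mem_radical_right hx _))
        · rintro _ ⟨a, b, h1, h2, h3, rfl⟩
          rw [SetLike.mem_coe, Submodule.mem_comap, hF]
          have hlt : posSum (u ++ a :: b :: v) < N := by
            have := posSum_append u v h2
            omega
          refine (sup_le_sup_left (Submodule.span_mono ?_) _ :
            straightWords R (u ++ a :: b :: v) ≤ _) (ih _ hlt _ rfl)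
          rintro _ ⟨l, hl1, hl2, hl3, rfl⟩
          refine ⟨l, hl1, ?_, fun h => hl3 (oddOrLong_append u v hmn h1 h2 h3 h), rfl⟩
          rw [hl2]
          simp only [List.sum_append, List.sum_cons]
          omega
      have := hle (h_mul_h_mem_straightPairs hmn)
      rwa [Submodule.mem_comap, hF] at this

/-! ### Linear independence of decreasing words -/

theorem elemSkew_hList_of_lt (l : List ℕ) (k : ℕ) (hk : l.countP (0 < ·) < k) :
    elemSkew R k (hList R l) = 0 := by
  induction l using List.reverseRecOn generalizing k with
  | nil =>
    rw [hList_nil, elemSkew_one, if_neg]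
    rintro rfl
    simp at hk
  | append_singleton l a ih =>
    rw [hList_append, hList_cons, hList_nil, mul_one]
    rw [List.countP_append] at hk
    rcases a with _ | a
    · rw [h_zero, mul_one, ih k (by omega)]
    · rcases k with _ | k
      · simp at hk
      · simp only [List.countP_cons, List.countP_nil, Nat.succ_pos, decide_true, if_true] at hk
        rw [elemSkew_succ_mul_h, ih (k + 1) (by omega), ih k (by omega)]
        simp

/-- Skewing by the number of letters must take one box from each letter; each other term of the
Leibniz rule skews by more than the number of letters left. -/
theorem elemSkew_length_hList (l : List ℕ) : ∃ s : R, s * s = 1 ∧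
    elemSkew R l.length (hList R (l.map (· + 1))) = s • hList R l := by
  induction l using List.reverseRecOn with
  | nil => exact ⟨1, by simp, by simp [hList_nil, elemSkew_one]⟩
  | append_singleton l a ih =>
    obtain ⟨s, hs, ih⟩ := ih
    refine ⟨(-1 : R) ^ (l.length * a) * s, ?_, ?_⟩
    · rw [mul_mul_mul_comm, hs, ← pow_add, mul_one]
      exact Even.neg_one_pow ⟨_, rfl⟩
    · rw [List.map_append, hList_append, hList_append, List.map_cons, List.map_nil, hList_cons,
        hList_cons, hList_nil, mul_one, mul_one, List.length_append, List.length_singleton,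
        elemSkew_succ_mul_h, ih, elemSkew_hList_of_lt, zero_mul, smul_zero, zero_add,
        smul_mul_assoc, smul_smul]
      refine lt_of_le_of_lt List.countP_le_length ?_
      simp

theorem eq_append_zero_of_pairwise {l : List ℕ} {r : ℕ} (hl : l.Pairwise (· ≥ ·))
    (hr : l.length = r + 1) (h0 : 0 ∈ l) : ∃ l', l = l' ++ [0] := by
  rcases List.eq_nil_or_concat' l with rfl | ⟨l', a, rfl⟩
  · simp at hr
  · refine ⟨l', ?_⟩
    rw [List.pairwise_append] at hl
    rcases List.mem_append.1 h0 with h | h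
    · have := hl.2.2 0 h a (by simp)
      rw [Nat.le_zero.1 this]
    · rw [List.mem_singleton.1 h]

/-- Double induction on the length `r` and the sum `N`, for lists padded by zeros. Skewing by `r`
kills the lists with a zero entry and lowers all entries of the others by one, which reduces `N`.
The lists with a zero entry end in zero, and dropping that entry reduces `r`. -/
theorem coeff_eq_zero_of_sum_mem_radical (r : ℕ) : ∀ (N : ℕ) (s : Finset (List ℕ)),
    (∀ l ∈ s, l.Pairwise (· ≥ ·) ∧ l.length = r ∧ l.sum = N) → ∀ c : List ℕ → R,
      ∑ l ∈ s, c l • hList R l ∈ radical R → ∀ l ∈ s, c l = 0 := by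
  induction r with
  | zero =>
    intro N s hs c hc l hl
    have hs' : s = {[]} := by
      refine Finset.eq_singleton_iff_unique_mem.2 ⟨?_, fun l' hl' => ?_⟩
      · rwa [← List.length_eq_zero_iff.1 (hs l hl).2.1]
      · exact List.length_eq_zero_iff.1 (hs l' hl').2.1
    have h11 : freeForm R (hWord R 1) 1 = 1 := by
      rw [← h_zero R, freeForm_hWord_h, weight_one, if_pos rfl]
    have := mem_radical_iff.1 hc 1
    rw [hs', Finset.sum_singleton, hList_nil, map_smul, h11, smul_eq_mul, mul_one] at this
    rwa [List.length_eq_zero_iff.1 (hs l hl).2.1]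
  | succ r ihr =>
    intro N
    induction N using Nat.strong_induction_on with
    | _ N ihN =>
      intro s hs c hc
      choose sgn hsgn hskew using elemSkew_length_hList (R := R)
      have hpos : ∀ l ∈ s, 0 ∉ l → c l = 0 := by
        have hsucc : ∀ l : List ℕ, 0 ∉ l → (l.map (· - 1)).map (· + 1) = l := by
          intro l hl
          rw [List.map_map]
          refine (List.map_congr_left fun x hx => ?_).trans l.map_id
          have : x ≠ 0 := fun h => hl (h ▸ hx)
          simp only [Function.comp_apply, id_eq]
          omega
        have hsum : ∀ l : List ℕ, (l.map (· + 1)).sum = l.sum + l.length := by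
          intro l
          simp [List.sum_map_add]
        let S : Finset (List ℕ) := s.filter fun l => 0 ∉ l
        have hinj : Set.InjOn (List.map (· - 1)) (S : Set (List ℕ)) := by
          intro l hl l' hl' h
          rw [← hsucc l (Finset.mem_filter.1 hl).2, ← hsucc l' (Finset.mem_filter.1 hl').2]
          exact congrArg _ h
        have hT : ∀ l ∈ S.image (List.map (· - 1)),
            l.Pairwise (· ≥ ·) ∧ l.length = r + 1 ∧ l.sum = N - (r + 1) := by
          intro l' hl'
          obtain ⟨l, hl, rfl⟩ := Finset.mem_image.1 hl'
          obtain ⟨hls, hl0⟩ := Finset.mem_filter.1 hl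
          obtain ⟨h1, h2, h3⟩ := hs l hls
          refine ⟨h1.map _ fun a b hab => Nat.sub_le_sub_right hab 1, by simpa using h2, ?_⟩
          have := hsum (l.map (· - 1))
          rw [hsucc l hl0, List.length_map] at this
          omega
        have hrad : ∑ l ∈ S.image (List.map (· - 1)), (c (l.map (· + 1)) * sgn l) • hList R l ∈
            radical R := by
          have := elemSkew_mem_radical hc (r + 1)
          rw [map_sum, ← Finset.sum_filter_add_sum_filter_not s (fun l => 0 ∉ l),
            Finset.sum_eq_zero (s := s.filter fun l => ¬ 0 ∉ l), add_zero] at this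
          · rw [Finset.sum_image hinj]
            convert this using 1
            refine Finset.sum_congr rfl fun l hl => ?_
            obtain ⟨hls, hl0⟩ := Finset.mem_filter.1 hl
            have h1 := hskew (l.map (· - 1))
            rw [hsucc l hl0, List.length_map, (hs l hls).2.1] at h1
            rw [hsucc l hl0, map_smul, h1, smul_smul]
          · intro l hl
            obtain ⟨hls, hl0⟩ := Finset.mem_filter.1 hl
            rw [map_smul, elemSkew_hList_of_lt, smul_zero]
            rw [← (hs l hls).2.1]
            refine lt_of_le_of_ne List.countP_le_length fun h => ?_
            have := List.countP_eq_length.1 h 0 (not_not.1 hl0)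
            simp at this
        intro l hl hl0
        have hlS : l ∈ S := Finset.mem_filter.2 ⟨hl, hl0⟩
        have hlT := Finset.mem_image_of_mem (List.map (· - 1)) hlS
        -- The subtraction is not truncated: `l` has `r + 1` positive entries with sum `N`.
        have hN : N - (r + 1) < N := by
          have h1 := hsum (l.map (· - 1))
          rw [hsucc l hl0, List.length_map, (hs l hl).2.1, (hs l hl).2.2] at h1
          omega
        have h2 := ihN _ hN _ hT (fun l => c (l.map (· + 1)) * sgn l) hrad _ hlT
        simp only [hsucc l hl0] at h2
        have h3 := congrArg (· * sgn (l.map (· - 1))) h2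
        simpa [mul_assoc, hsgn] using h3
      intro l hl
      by_cases hl0 : 0 ∈ l
      · let S : Finset (List ℕ) := s.filter fun l => 0 ∈ l
        have hlast : ∀ l ∈ S, l.dropLast ++ [0] = l := by
          intro l hl
          obtain ⟨hls, hl0⟩ := Finset.mem_filter.1 hl
          obtain ⟨l', rfl⟩ := eq_append_zero_of_pairwise (hs l hls).1 (hs l hls).2.1 hl0
          simp
        have hinj : Set.InjOn List.dropLast (S : Set (List ℕ)) := by
          intro l hl l' hl' h
          rw [← hlast l hl, ← hlast l' hl', h]
        have hT : ∀ l ∈ S.image List.dropLast,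
            l.Pairwise (· ≥ ·) ∧ l.length = r ∧ l.sum = N := by
          intro l' hl'
          obtain ⟨l, hl, rfl⟩ := Finset.mem_image.1 hl'
          have hls := (Finset.mem_filter.1 hl).1
          obtain ⟨h1, h2, h3⟩ := hs l hls
          rw [← hlast l hl] at h3
          refine ⟨h1.sublist (List.dropLast_sublist l), by simp [h2], by simpa using h3⟩
        have hrad : ∑ l ∈ S.image List.dropLast, c (l ++ [0]) • hList R l ∈ radical R := by
          rw [← Finset.sum_filter_add_sum_filter_not s (fun l => 0 ∈ l),
            Finset.sum_eq_zero (s := s.filter fun l => ¬ 0 ∈ l), add_zero] at hc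
          · rw [Finset.sum_image hinj]
            convert hc using 1
            refine Finset.sum_congr rfl fun l hl => ?_
            rw [hlast l hl]
            congr 1
            conv_rhs => rw [← hlast l hl]
            rw [hList_append, hList_cons, hList_nil, h_zero, mul_one, mul_one]
          · intro l hl
            obtain ⟨hls, hl0⟩ := Finset.mem_filter.1 hl
            rw [hpos l hls hl0, zero_smul]
        have hlS : l ∈ S := Finset.mem_filter.2 ⟨hl, hl0⟩
        have := ihr N _ hT (fun l => c (l ++ [0])) hrad _ (Finset.mem_image_of_mem _ hlS)
        simpa only [hlast l hlS] using this
      · exact hpos l hl hl0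

end

/-! ### Partitions -/

/-- The parts of a partition in decreasing order. -/
def partList {n : ℕ} (p : n.Partition) : List ℕ := p.parts.sort (· ≥ ·)

theorem coe_partList {n : ℕ} (p : n.Partition) : (partList p : Multiset ℕ) = p.parts :=
  Multiset.sort_eq _ _

theorem sum_partList {n : ℕ} (p : n.Partition) : (partList p).sum = n := by
  rw [← Multiset.sum_coe, coe_partList, p.parts_sum]

theorem length_partList {n : ℕ} (p : n.Partition) : (partList p).length = p.parts.card := by
  rw [← Multiset.coe_card, coe_partList]

theorem card_parts_le {n : ℕ} (p : n.Partition) : p.parts.card ≤ n := by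
  have := Multiset.card_nsmul_le_sum (s := p.parts) (a := 1) fun x hx => p.parts_pos hx
  simpa [p.parts_sum] using this

/-- The parts of a partition of `n` in decreasing order, padded by zeros to length `n`. -/
def paddedPartList {n : ℕ} (p : n.Partition) : List ℕ :=
  partList p ++ List.replicate (n - p.parts.card) 0

theorem paddedPartList_injective {n : ℕ} :
    Function.Injective (paddedPartList : n.Partition → List ℕ) := by
  intro p q hpq
  have key : ∀ p : n.Partition, ((paddedPartList p).filter (· ≠ 0) : Multiset ℕ) = p.parts := by
    intro p
    have h1 : (partList p).filter (· ≠ 0) = partList p := by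
      rw [List.filter_eq_self]
      intro a ha
      have : a ∈ p.parts := by
        rw [← coe_partList]
        exact ha
      simpa using (p.parts_pos this).ne'
    rw [paddedPartList, List.filter_append, h1, List.filter_replicate]
    simp [coe_partList]
  ext1
  rw [← key p, ← key q, hpq]

theorem paddedPartList_spec {n : ℕ} (p : n.Partition) :
    (paddedPartList p).Pairwise (· ≥ ·) ∧ (paddedPartList p).length = n ∧
      (paddedPartList p).sum = n := by
  refine ⟨?_, ?_, ?_⟩
  · rw [paddedPartList, List.pairwise_append]
    refine ⟨Multiset.pairwise_sort _ _, List.pairwise_replicate.2 (Or.inr le_rfl), ?_⟩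
    intro a _ b hb
    rw [List.eq_of_mem_replicate hb]
    exact Nat.zero_le a
  · rw [paddedPartList, List.length_append, length_partList, List.length_replicate,
      Nat.add_sub_cancel' (card_parts_le p)]
  · simp [paddedPartList, sum_partList]

section

variable {R : Type*} [CommRing R]

theorem hPartition_eq {n : ℕ} (p : n.Partition) : hPartition R p = proj R (hList R (partList p)) :=
  rfl

theorem hList_replicate_zero (j : ℕ) : hList R (List.replicate j 0) = 1 := by
  simp [hList, h_zero]

theorem hPartition_eq_padded {n : ℕ} (p : n.Partition) :
    hPartition R p = proj R (hList R (paddedPartList p)) := by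
  rw [paddedPartList, hList_append, hList_replicate_zero, mul_one, hPartition_eq]

theorem hList_filter (l : List ℕ) : hList R (l.filter (· ≠ 0)) = hList R l := by
  induction l with
  | nil => rfl
  | cons a l ih =>
    by_cases ha : a = 0
    · rw [List.filter_cons_of_neg (by simpa using ha), ih, hList_cons, ha, h_zero, one_mul]
    · rw [List.filter_cons_of_pos (by simpa using ha), hList_cons, hList_cons, ih]

theorem exists_hPartition_eq {n : ℕ} {l : List ℕ} (hl : l.Pairwise (· ≥ ·)) (hn : l.sum = n) :
    ∃ p : n.Partition, hPartition R p = proj R (hList R l) ∧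
      p.parts.card = l.countP (0 < ·) := by
  refine ⟨Nat.Partition.ofSums n l (by simpa using hn), ?_, ?_⟩
  · rw [hPartition_eq, ← hList_filter l]
    congr 2
    refine List.Perm.eq_of_pairwise' (r := (· ≥ ·)) (Multiset.pairwise_sort _ _)
      (hl.sublist List.filter_sublist) ?_
    rw [← Multiset.coe_eq_coe, coe_partList]
    simp [Nat.Partition.ofSums]
  · simp [Nat.Partition.ofSums, List.countP_eq_length_filter, Nat.pos_iff_ne_zero]

theorem proj_eq_zero_iff {x : FreeH R} : proj R x = 0 ↔ x ∈ radical R :=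
  Submodule.Quotient.mk_eq_zero _

/-- The restriction on `p` is what makes `m_n` primitive: for `n` even, a word with at least two
letters has no component along the one-row `h_n`. -/
theorem proj_hWord_mem_span (w : FreeMonoid ℕ+) {n : ℕ} (hw : weight w = n) :
    proj R (hWord R w) ∈ Submodule.span R {x | ∃ p : n.Partition,
      (2 ≤ w.toList.length → Odd n ∨ 2 ≤ p.parts.card) ∧ x = hPartition R p} := by
  have hlen : (w.toList.map (fun a : ℕ+ => (a : ℕ))).countP (0 < ·) = w.toList.length := by
    rw [List.countP_map, List.countP_eq_length]
    intro a _
    simp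
  have hle : straightWords R (w.toList.map (fun a : ℕ+ => (a : ℕ))) ≤
      (Submodule.span R {x | ∃ p : n.Partition,
        (2 ≤ w.toList.length → Odd n ∨ 2 ≤ p.parts.card) ∧ x = hPartition R p}).comap (proj R) := by
    refine sup_le (fun x hx => ?_) (Submodule.span_le.2 ?_)
    · rw [Submodule.mem_comap, proj_eq_zero_iff.2 hx]
      exact zero_mem _
    · rintro _ ⟨l, hl1, hl2, hl3, rfl⟩
      have hl : l.sum = n := hl2.trans hw
      obtain ⟨p, hp1, hp2⟩ := exists_hPartition_eq (R := R) hl1 hl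
      refine Submodule.subset_span ⟨p, fun h2 => ?_, hp1.symm⟩
      have := hl3 (Or.inr (by rwa [hlen]))
      rwa [OddOrLong, hl, ← hp2] at this
  rw [hWord_eq_hList]
  exact hle (hList_mem_straightWords _)

theorem hPartition_mem_degreePart {n : ℕ} (p : n.Partition) :
    hPartition R p ∈ degreePart R n := by
  have := hList_mem (R := R) (partList p)
  rw [sum_partList] at this
  exact ⟨_, this, rfl⟩

theorem degreePart_eq_span (n : ℕ) :
    degreePart R n = Submodule.span R (Set.range (hPartition R : n.Partition → OddSym R)) := by
  refine le_antisymm ?_ (Submodule.span_le.2 ?_)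
  · rw [degreePart, grading, Submodule.map_span, Submodule.span_le]
    rintro _ ⟨_, ⟨w, hw, rfl⟩, rfl⟩
    refine Submodule.span_mono ?_ (proj_hWord_mem_span w hw)
    rintro _ ⟨p, -, rfl⟩
    exact ⟨p, rfl⟩
  · rintro _ ⟨p, rfl⟩
    exact hPartition_mem_degreePart p

theorem linearIndependent_hPartition (n : ℕ) :
    LinearIndependent R (hPartition R : n.Partition → OddSym R) := by
  rw [Fintype.linearIndependent_iff]
  intro c hc p
  let c' : List ℕ → R := Function.extend paddedPartList c 0
  -- Padding to the common length `n` makes `coeff_eq_zero_of_sum_mem_radical` applicable to all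
  -- partitions of `n` at once.
  have hc' : ∀ p, c' (paddedPartList p) = c p := paddedPartList_injective.extend_apply c 0
  rw [← hc' p]
  refine coeff_eq_zero_of_sum_mem_radical n n (Finset.univ.image paddedPartList) ?_ c' ?_ _
    (Finset.mem_image_of_mem _ (Finset.mem_univ p))
  · intro l hl
    obtain ⟨q, -, rfl⟩ := Finset.mem_image.1 hl
    exact paddedPartList_spec q
  · rw [Finset.sum_image paddedPartList_injective.injOn, ← proj_eq_zero_iff, map_sum, ← hc]
    refine Finset.sum_congr rfl fun q _ => ?_
    rw [map_smul, hc', hPartition_eq_padded]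

/-! ### The form on `Λ` -/

theorem eq_zero_of_form {x : OddSym R} (hx : ∀ w, form R (proj R (hWord R w)) x = 0) : x = 0 := by
  obtain ⟨x, rfl⟩ := (radical R).mkQ_surjective x
  exact proj_eq_zero_iff.2 (mem_radical_iff.2 hx)

theorem form_proj_eq_zero {i j : ℕ} (hij : i ≠ j) {x : FreeH R} (hx : x ∈ grading R i)
    {y : OddSym R} (hy : y ∈ degreePart R j) : form R (proj R x) y = 0 := by
  obtain ⟨y, hy, rfl⟩ := hy
  exact freeForm_eq_zero_of_mem hij hx hy

theorem eq_zero_of_form_hPartition {n : ℕ} {x : OddSym R} (hx : x ∈ degreePart R n)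
    (h0 : ∀ p : n.Partition, form R (hPartition R p) x = 0) : x = 0 := by
  refine eq_zero_of_form fun w => ?_
  by_cases hw : weight w = n
  · have hmem : proj R (hWord R w) ∈ degreePart R n := hw ▸ ⟨_, hWord_mem R w, rfl⟩
    have hle : degreePart R n ≤ LinearMap.ker ((form R).flip x) := by
      rw [degreePart_eq_span, Submodule.span_le]
      rintro _ ⟨p, rfl⟩
      exact h0 p
    exact hle hmem
  · exact form_proj_eq_zero hw (hWord_mem R w) hx

end

section Field

variable {k : Type*} [Field k]

/-- The pairings with the `h_λ` as a linear map on the homogeneous part of degree `n`. -/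
def evalPartitions (k : Type*) [Field k] (n : ℕ) : degreePart k n →ₗ[k] (n.Partition → k) :=
  LinearMap.pi fun p => form k (hPartition k p) ∘ₗ (degreePart k n).subtype

/-- Injective because the form is nondegenerate and the `h_λ` span the degree; bijective because
they are also independent, so both sides have the same dimension. -/
theorem evalPartitions_bijective (n : ℕ) : Function.Bijective (evalPartitions k n) := by
  have hinj : Function.Injective (evalPartitions k n) := by
    rw [injective_iff_map_eq_zero]
    rintro ⟨x, hx⟩ h0
    exact Subtype.ext (eq_zero_of_form_hPartition hx fun p => congrFun h0 p)
  have hfin : FiniteDimensional k (degreePart k n) := by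
    rw [degreePart_eq_span]
    exact FiniteDimensional.span_of_finite k (Set.finite_range _)
  refine ⟨hinj, (LinearMap.injective_iff_surjective_of_finrank_eq_finrank ?_).1 hinj⟩
  rw [degreePart_eq_span, finrank_span_eq_card (linearIndependent_hPartition n),
    Module.finrank_fintype_fun_eq_card]

theorem existsUnique_isMonomialFamily (k : Type*) [Field k] :
    ∃! m : (n : ℕ) → n.Partition → OddSym k, IsMonomialFamily k m := by
  have hex : ∀ (n : ℕ) (q : n.Partition), ∃ x : degreePart k n,
      evalPartitions k n x = fun p => if p = q then 1 else 0 :=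
    fun n q => (evalPartitions_bijective n).2 _
  choose m hm using hex
  refine ⟨fun n q => m n q, fun n => ⟨fun q => (m n q).2, fun p q => congrFun (hm n q) p⟩, ?_⟩
  intro m' hm'
  funext n q
  have : (⟨m' n q, (hm' n).1 q⟩ : degreePart k n) = m n q := by
    refine (evalPartitions_bijective n).1 ?_
    rw [hm]
    exact funext fun p => (hm' n).2 p q
  exact congrArg Subtype.val this

/-! ### The comultiplication of `Λ` -/

/-- Over a field, write `t = ∑ t_i ⊗ b_i` with a basis `b`. Contracting the first factor with a word
gives an element orthogonal to all words, hence zero; its coordinates are the pairings of the `t_i`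
with that word, so each `t_i` vanishes. -/
theorem eq_zero_of_tensorFun {t : OddSym k ⊗[k] OddSym k}
    (ht : ∀ u v, tensorFun (form k (proj k (hWord k u))) (form k (proj k (hWord k v))) t = 0) :
    t = 0 := by
  classical
  let b := Module.Basis.ofVectorSpace k (OddSym k)
  have h1 : ∀ φ : OddSym k →ₗ[k] k, ∀ y, form k y
      (TensorProduct.lid k _ (LinearMap.rTensor _ φ t)) = tensorFun φ (form k y) t := by
    intro φ y
    have : form k y ∘ₗ (TensorProduct.lid k _).toLinearMap ∘ₗ LinearMap.rTensor _ φ =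
        tensorFun φ (form k y) := by
      refine TensorProduct.ext' fun x z => ?_
      simp [tensorFun_tmul]
    exact LinearMap.congr_fun this t
  have h2 : ∀ (φ : OddSym k →ₗ[k] k) i,
      b.repr (TensorProduct.lid k _ (LinearMap.rTensor _ φ t)) i =
        φ (TensorProduct.equivFinsuppOfBasisRight b t i) := by
    intro φ i
    have : b.coord i ∘ₗ (TensorProduct.lid k _).toLinearMap ∘ₗ LinearMap.rTensor _ φ =
        φ ∘ₗ Finsupp.lapply i ∘ₗ (TensorProduct.equivFinsuppOfBasisRight b).toLinearMap := by
      refine TensorProduct.ext' fun x z => ?_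
      simp [mul_comm]
    exact LinearMap.congr_fun this t
  rw [← (TensorProduct.equivFinsuppOfBasisRight b).map_eq_zero_iff]
  ext i
  rw [Finsupp.zero_apply]
  refine eq_zero_of_form fun u => ?_
  rw [← h2, eq_zero_of_form (R := k) (x := TensorProduct.lid k _ _), map_zero, Finsupp.zero_apply]
  intro v
  rw [h1, ht]

theorem tensorFun_form_map_proj (x y : FreeH k) (t : FreeH k ⊗[k] FreeH k) :
    tensorFun (form k (proj k x)) (form k (proj k y)) (TensorProduct.map (proj k) (proj k) t) =
      tensorFun (freeForm k x) (freeForm k y) t := by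
  have : tensorFun (form k (proj k x)) (form k (proj k y)) ∘ₗ
      TensorProduct.map (proj k) (proj k) = tensorFun (freeForm k x) (freeForm k y) := by
    refine TensorProduct.ext' fun a b => ?_
    simp [tensorFun_tmul, form_proj]
  exact LinearMap.congr_fun this t

theorem existsUnique_isInheritedComul (k : Type*) [Field k] :
    ∃! Δ : OddSym k →ₗ[k] OddSym k ⊗[k] OddSym k, IsInheritedComul k Δ := by
  refine ⟨(radical k).liftQ (TensorProduct.map (proj k) (proj k) ∘ₗ freeComulLin k) ?_,
    fun x => rfl, fun Δ hΔ => ?_⟩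
  · intro x hx
    refine eq_zero_of_tensorFun fun u v => ?_
    rw [LinearMap.comp_apply, tensorFun_form_map_proj, ← freeForm_mul, freeForm_eq_zero hx]
  · refine Submodule.linearMap_qext _ (LinearMap.ext fun x => ?_)
    exact hΔ x

theorem tensorFun_form_comul {Δ : OddSym k →ₗ[k] OddSym k ⊗[k] OddSym k}
    (hΔ : IsInheritedComul k Δ) (x y : FreeH k) (z : OddSym k) :
    tensorFun (form k (proj k x)) (form k (proj k y)) (Δ z) = form k (proj k (x * y)) z := by
  obtain ⟨z, rfl⟩ := (radical k).mkQ_surjective z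
  exact (congrArg _ (hΔ z)).trans ((tensorFun_form_map_proj x y _).trans (freeForm_mul k x y z).symm)

/-! ### Primitive elements -/

open scoped Classical in
theorem form_unit (u : FreeMonoid ℕ+) :
    form k (proj k (hWord k u)) (unit k) = if u = 1 then 1 else 0 := by
  have h0 : form k (proj k (hWord k u)) (unit k) = if weight u = 0 then 1 else 0 := by
    rw [← freeForm_hWord_h, h_zero]
    rfl
  rw [h0]
  rcases eq_one_or_eq_mul_of u with rfl | ⟨u, a, rfl⟩
  · simp [weight_one]
  · have h1 : weight (u * FreeMonoid.of a) ≠ 0 := by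
      have := a.pos
      rw [weight_mul, weight_of]
      omega
    rw [if_neg h1, if_neg]
    intro h
    rw [h, weight_one] at h1
    exact h1 rfl

/-- By adjointness, testing `Δ z` against `u ⊗ v` computes the pairing of `z` with `u * v`, while `1
⊗ z + z ⊗ 1` pairs to zero unless `u` or `v` is empty. The case `u = v = 1` gives `(1, z) = 2 (1,
z)`. -/
theorem mem_primitives_iff {Δ : OddSym k →ₗ[k] OddSym k ⊗[k] OddSym k}
    (hΔ : IsInheritedComul k Δ) {z : OddSym k} :
    z ∈ primitives k Δ ↔ form k (unit k) z = 0 ∧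
      ∀ w : FreeMonoid ℕ+, 2 ≤ w.toList.length → form k (proj k (hWord k w)) z = 0 := by
  classical
  have hunit : unit k = proj k (hWord k 1) := by rw [hWord_one]; rfl
  have hpair : ∀ u v, tensorFun (form k (proj k (hWord k u))) (form k (proj k (hWord k v)))
      (unit k ⊗ₜ z + z ⊗ₜ unit k) = (if u = 1 then 1 else 0) * form k (proj k (hWord k v)) z +
        form k (proj k (hWord k u)) z * if v = 1 then 1 else 0 := by
    intro u v
    rw [map_add, tensorFun_tmul, tensorFun_tmul, form_unit, form_unit]
  constructor
  · intro hz
    have hz : Δ z = unit k ⊗ₜ z + z ⊗ₜ unit k := hz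
    have key : ∀ u v, form k (proj k (hWord k (u * v))) z =
        (if u = 1 then 1 else 0) * form k (proj k (hWord k v)) z +
        form k (proj k (hWord k u)) z * if v = 1 then 1 else 0 := by
      intro u v
      rw [hWord_mul, ← tensorFun_form_comul hΔ, hz, hpair]
    refine ⟨?_, fun w hw => ?_⟩
    · have := key 1 1
      rw [mul_one, if_pos rfl, one_mul, mul_one, ← hunit] at this
      exact left_eq_add.1 this
    · rcases eq_one_or_eq_mul_of w with rfl | ⟨u, a, rfl⟩
      · simp at hw
      · rw [key, if_neg, if_neg (FreeMonoid.of_ne_one a)]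
        · simp
        · rintro rfl
          simp at hw
  · rintro ⟨h1, h2⟩
    refine sub_eq_zero.1 (eq_zero_of_tensorFun fun u v => ?_)
    rw [map_sub, hpair, tensorFun_form_comul hΔ, ← hWord_mul, sub_eq_zero]
    by_cases hu : u = 1
    · rw [hu, one_mul, if_pos rfl, one_mul, ← hunit, h1, zero_mul, add_zero]
    · by_cases hv : v = 1
      · rw [hv, mul_one, if_pos rfl, mul_one, ← hunit, h1, mul_zero, zero_add]
      · rw [if_neg hu, if_neg hv, zero_mul, mul_zero, add_zero]
        refine h2 _ ?_
        have hpos : ∀ u : FreeMonoid ℕ+, u ≠ 1 → 0 < u.toList.length := fun u hu =>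
          List.length_pos_iff.2 fun h => hu (FreeMonoid.toList.injective h)
        have := hpos u hu
        have := hpos v hv
        rw [FreeMonoid.toList_mul, List.length_append]
        omega

theorem eq_zero_of_mem_primitives {Δ : OddSym k →ₗ[k] OddSym k ⊗[k] OddSym k}
    (hΔ : IsInheritedComul k Δ) {z : OddSym k} (hz : z ∈ primitives k Δ)
    (h0 : ∀ a, 0 < a → form k (proj k (h k a)) z = 0) : z = 0 := by
  obtain ⟨h1, h2⟩ := (mem_primitives_iff hΔ).1 hz
  refine eq_zero_of_form fun w => ?_
  rcases eq_one_or_eq_mul_of w with rfl | ⟨u, a, rfl⟩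
  · rw [hWord_one]
    exact h1
  · rcases eq_one_or_eq_mul_of u with rfl | ⟨u, b, rfl⟩
    · rw [one_mul, hWord_of]
      exact h0 a a.pos
    · exact h2 _ (by simp)

/-- The degrees in which there are nonzero primitive elements. -/
def IsPrimitiveDegree (n : ℕ) : Prop := n = 1 ∨ (Even n ∧ 0 < n)

/-- Here `n = a + 1` with `a` even and positive, and `2 h_{a+1} = h_a h_1 + h_1 h_a` in `Λ`; the
right side is orthogonal to primitive elements, and `2` is invertible. -/
theorem form_h_eq_zero_of_mem_primitives [CharZero k]
    {Δ : OddSym k →ₗ[k] OddSym k ⊗[k] OddSym k} (hΔ : IsInheritedComul k Δ) {z : OddSym k}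
    (hz : z ∈ primitives k Δ) {n : ℕ} (hn : ¬ IsPrimitiveDegree n) (hn0 : 0 < n) :
    form k (proj k (h k n)) z = 0 := by
  obtain ⟨-, h2⟩ := (mem_primitives_iff hΔ).1 hz
  rw [IsPrimitiveDegree] at hn
  push Not at hn
  obtain ⟨a, rfl⟩ : ∃ a, n = a + 1 := ⟨n - 1, by omega⟩
  have ha : Even a := by
    have : ¬ Even (a + 1) := fun he => absurd (hn.2 he) (by omega)
    rw [Nat.even_add_one, not_not] at this
    exact this
  have hrel := h_relation_even_odd (R := k) ha (n := 0) (by simp)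
  obtain ⟨z, rfl⟩ := (radical k).mkQ_surjective z
  have h3 : ∀ b c : ℕ, 0 < b → 0 < c → freeForm k (h k b * h k c) z = 0 := by
    intro b c hb hc
    obtain ⟨b, rfl⟩ : ∃ d : ℕ+, (d : ℕ) = b := ⟨⟨b, hb⟩, rfl⟩
    obtain ⟨c, rfl⟩ : ∃ d : ℕ+, (d : ℕ) = c := ⟨⟨c, hc⟩, rfl⟩
    have := h2 (FreeMonoid.of b * FreeMonoid.of c) (by simp)
    rw [hWord_mul, hWord_of, hWord_of] at this
    exact this
  have ha0 : 0 < a := by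
    rcases Nat.eq_zero_or_pos a with rfl | h
    · exact absurd rfl hn.1
    · exact h
  have h4 := freeForm_eq_zero hrel z
  rw [freeForm_comm, map_sub, map_sub, map_add, LinearMap.sub_apply, LinearMap.sub_apply,
    LinearMap.add_apply, h_zero, mul_one, one_mul, zero_add, h3 a 1 ha0 one_pos,
    h3 1 a one_pos ha0] at h4
  have h5 : (2 : k) * freeForm k (h k (a + 1)) z = 0 := by linear_combination -h4
  exact (mul_eq_zero.1 h5).resolve_left two_ne_zero

/-! ### One-row monomial functions and the span of the primitive elements -/

theorem hPartition_indiscrete {n : ℕ} (hn : n ≠ 0) :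
    hPartition k (Nat.Partition.indiscrete n) = proj k (h k n) := by
  rw [hPartition, Nat.Partition.indiscrete_parts hn]
  simp

theorem form_h_oneRow {m : (n : ℕ) → n.Partition → OddSym k} (hm : IsMonomialFamily k m)
    {n : ℕ} (hn : 0 < n) (a : ℕ) :
    form k (proj k (h k a)) (oneRow m n) = if a = n then 1 else 0 := by
  split_ifs with h
  · rw [h, ← hPartition_indiscrete hn.ne', oneRow, (hm n).2, if_pos rfl]
  · exact form_proj_eq_zero h (h_mem k a) ((hm n).1 _)

theorem oneRow_mem_primitives {Δ : OddSym k →ₗ[k] OddSym k ⊗[k] OddSym k}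
    (hΔ : IsInheritedComul k Δ) {m : (n : ℕ) → n.Partition → OddSym k}
    (hm : IsMonomialFamily k m) {n : ℕ} (hn : IsPrimitiveDegree n) :
    oneRow m n ∈ primitives k Δ := by
  have hn0 : 0 < n := by
    rcases hn with h | h
    · omega
    · exact h.2
  rw [mem_primitives_iff hΔ]
  refine ⟨form_proj_eq_zero hn0.ne SetLike.GradedOne.one_mem ((hm n).1 _), fun w hw => ?_⟩
  by_cases hwn : weight w = n
  · rcases hn with rfl | ⟨hn, -⟩
    · rcases eq_one_or_eq_mul_of w with rfl | ⟨u, a, rfl⟩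
      · simp at hw
      · rcases eq_one_or_eq_mul_of u with rfl | ⟨u, b, rfl⟩
        · simp at hw
        · rw [weight_mul, weight_mul, weight_of, weight_of] at hwn
          have := a.pos
          have := b.pos
          omega
    · have hle : Submodule.span k {x | ∃ p : n.Partition,
          (2 ≤ w.toList.length → Odd n ∨ 2 ≤ p.parts.card) ∧ x = hPartition k p} ≤
          LinearMap.ker ((form k).flip (oneRow m n)) := by
        rw [Submodule.span_le]
        rintro _ ⟨p, hp, rfl⟩
        have hp := (hp hw).resolve_left (Nat.not_odd_iff_even.2 hn)
        refine ((hm n).2 p _).trans (if_neg ?_)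
        rintro rfl
        rw [Nat.Partition.indiscrete_parts hn0.ne'] at hp
        simp at hp
      exact hle (proj_hWord_mem_span w hwn)
  · exact form_proj_eq_zero hwn (hWord_mem k w) ((hm n).1 _)

/-- An element of `Λ` has components in only finitely many degrees; this makes the sum in
`mem_span_of_mem_primitives` finite. -/
theorem exists_form_h_eq_zero (x : OddSym k) :
    ∃ N, ∀ n, N ≤ n → form k (proj k (h k n)) x = 0 := by
  obtain ⟨x, rfl⟩ := (radical k).mkQ_surjective x
  induction (hBasis k).mem_span x using Submodule.span_induction with
  | mem x hx =>
    obtain ⟨w, rfl⟩ := hx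
    refine ⟨weight w + 1, fun n hn => ?_⟩
    rw [hBasis_apply]
    exact (freeForm_h_hWord k n w).trans (if_neg (by omega))
  | zero => exact ⟨0, fun n _ => by simp⟩
  | add x y _ _ hx hy =>
    obtain ⟨N, hN⟩ := hx
    obtain ⟨N', hN'⟩ := hy
    refine ⟨max N N', fun n hn => ?_⟩
    rw [map_add, map_add, hN n (le_of_max_le_left hn), hN' n (le_of_max_le_right hn), add_zero]
  | smul c x _ hx =>
    obtain ⟨N, hN⟩ := hx
    refine ⟨N, fun n hn => ?_⟩
    rw [map_smul, map_smul, hN n hn, smul_zero]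

theorem mem_span_of_mem_primitives [CharZero k]
    {Δ : OddSym k →ₗ[k] OddSym k ⊗[k] OddSym k} (hΔ : IsInheritedComul k Δ)
    {m : (n : ℕ) → n.Partition → OddSym k} (hm : IsMonomialFamily k m) {x : OddSym k}
    (hx : x ∈ primitives k Δ) :
    x ∈ Submodule.span k {y | ∃ n, IsPrimitiveDegree n ∧ y = oneRow m n} := by
  classical
  obtain ⟨N, hN⟩ := exists_form_h_eq_zero x
  -- The candidate expansion: `m_n` is dual to the single letters, so its coefficient must be the
  -- pairing of `x` with `h_n`. The difference `x - y` is primitive and orthogonal to every single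
  -- letter.
  let y : OddSym k := ∑ n ∈ (Finset.range N).filter IsPrimitiveDegree,
    form k (proj k (h k n)) x • oneRow m n
  have hpos : ∀ n, IsPrimitiveDegree n → 0 < n := by
    rintro n (h | h)
    · omega
    · exact h.2
  have hxy : x - y = 0 := by
    refine eq_zero_of_mem_primitives hΔ (sub_mem hx (sum_mem fun n hn => ?_)) fun a ha => ?_
    · exact Submodule.smul_mem _ _ (oneRow_mem_primitives hΔ hm (Finset.mem_filter.1 hn).2)
    · rw [map_sub, map_sum, sub_eq_zero]
      have hterm : ∀ n ∈ (Finset.range N).filter IsPrimitiveDegree,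
          form k (proj k (h k a)) (form k (proj k (h k n)) x • oneRow m n) =
            if a = n then form k (proj k (h k n)) x else 0 := by
        intro n hn
        rw [map_smul, form_h_oneRow hm (hpos n (Finset.mem_filter.1 hn).2)]
        simp
      rw [Finset.sum_congr rfl hterm, Finset.sum_ite_eq]
      split_ifs with h
      · rfl
      · by_cases haN : a < N
        · have : ¬ IsPrimitiveDegree a := fun hd =>
            h (Finset.mem_filter.2 ⟨Finset.mem_range.2 haN, hd⟩)
          exact form_h_eq_zero_of_mem_primitives hΔ hx this ha
        · exact hN a (not_lt.1 haN)
  rw [sub_eq_zero.1 hxy]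
  refine sum_mem fun n hn => Submodule.smul_mem _ _ (Submodule.subset_span ?_)
  exact ⟨n, (Finset.mem_filter.1 hn).2, rfl⟩

theorem primitives_eq_span [CharZero k]
    {Δ : OddSym k →ₗ[k] OddSym k ⊗[k] OddSym k} (hΔ : IsInheritedComul k Δ)
    {m : (n : ℕ) → n.Partition → OddSym k} (hm : IsMonomialFamily k m) :
    primitives k Δ = Submodule.span k {y | ∃ n, IsPrimitiveDegree n ∧ y = oneRow m n} := by
  refine le_antisymm (fun x hx => mem_span_of_mem_primitives hΔ hm hx) (Submodule.span_le.2 ?_)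
  rintro _ ⟨n, hn, rfl⟩
  exact oneRow_mem_primitives hΔ hm hn

theorem primitives_inf_degreePart {Δ : OddSym k →ₗ[k] OddSym k ⊗[k] OddSym k}
    (hΔ : IsInheritedComul k Δ) {m : (n : ℕ) → n.Partition → OddSym k}
    (hm : IsMonomialFamily k m) {n : ℕ} (hn : IsPrimitiveDegree n) :
    primitives k Δ ⊓ degreePart k n = Submodule.span k {oneRow m n} := by
  have hn0 : 0 < n := by
    rcases hn with h | h
    · omega
    · exact h.2
  refine le_antisymm ?_ ?_
  · rintro x ⟨hx, hxn⟩
    rw [Submodule.mem_span_singleton]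
    refine ⟨form k (proj k (h k n)) x, ?_⟩
    refine (sub_eq_zero.1 (eq_zero_of_mem_primitives hΔ (sub_mem hx
      (Submodule.smul_mem _ _ (oneRow_mem_primitives hΔ hm hn))) fun a _ => ?_)).symm
    rw [map_sub, map_smul, form_h_oneRow hm hn0]
    by_cases ha : a = n
    · simp [ha]
    · rw [form_proj_eq_zero ha (h_mem k a) hxn]
      simp [ha]
  · rw [Submodule.span_singleton_le_iff_mem]
    exact ⟨oneRow_mem_primitives hΔ hm hn, (hm n).1 _⟩

theorem primitives_inf_degreePart_eq_bot [CharZero k]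
    {Δ : OddSym k →ₗ[k] OddSym k ⊗[k] OddSym k} (hΔ : IsInheritedComul k Δ) {n : ℕ}
    (hn : ¬ IsPrimitiveDegree n) : primitives k Δ ⊓ degreePart k n = ⊥ := by
  rw [eq_bot_iff]
  rintro x ⟨hx, hxn⟩
  refine (Submodule.mem_bot k).2 (eq_zero_of_mem_primitives hΔ hx fun a ha => ?_)
  by_cases h : a = n
  · rw [h] at ha ⊢
    exact form_h_eq_zero_of_mem_primitives hΔ hx hn ha
  · exact form_proj_eq_zero h (h_mem k a) hxn

end Field

end OddSymm

end

theorem mainTheorem7 (k : Type*) [Field k] [CharZero k] :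
    (∃! Δ : OddSymm.OddSym k →ₗ[k] OddSymm.OddSym k ⊗[k] OddSymm.OddSym k,
      OddSymm.IsInheritedComul k Δ) ∧
    (∃! m : (n : ℕ) → n.Partition → OddSymm.OddSym k, OddSymm.IsMonomialFamily k m) ∧
    ∀ (Δ : OddSymm.OddSym k →ₗ[k] OddSymm.OddSym k ⊗[k] OddSymm.OddSym k)
      (m : (n : ℕ) → n.Partition → OddSymm.OddSym k),
      OddSymm.IsInheritedComul k Δ → OddSymm.IsMonomialFamily k m →
        OddSymm.primitives k Δ =
          Submodule.span k ({OddSymm.oneRow m 1} ∪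
            {x | ∃ j : ℕ, 1 ≤ j ∧ x = OddSymm.oneRow m (2 * j)}) ∧
        (∀ n : ℕ, n = 1 ∨ (Even n ∧ 0 < n) →
          Module.finrank k
            (OddSymm.primitives k Δ ⊓ OddSymm.degreePart k n : Submodule k (OddSymm.OddSym k)) = 1) ∧
        (∀ n : ℕ, n = 0 ∨ (Odd n ∧ 3 ≤ n) →
          OddSymm.primitives k Δ ⊓ OddSymm.degreePart k n = ⊥) := by
  refine ⟨OddSymm.existsUnique_isInheritedComul k, OddSymm.existsUnique_isMonomialFamily k,
    fun Δ m hΔ hm => ⟨?_, fun n hn => ?_, fun n hn => ?_⟩⟩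
  · rw [OddSymm.primitives_eq_span hΔ hm]
    congr 1
    ext x
    constructor
    · rintro ⟨n, rfl | ⟨⟨j, rfl⟩, hj⟩, rfl⟩
      · exact Or.inl rfl
      · exact Or.inr ⟨j, by omega, by rw [two_mul]⟩
    · rintro (rfl | ⟨j, hj, rfl⟩)
      · exact ⟨1, Or.inl rfl, rfl⟩
      · exact ⟨2 * j, Or.inr ⟨even_two_mul j, by omega⟩, rfl⟩
  · rw [OddSymm.primitives_inf_degreePart hΔ hm hn]
    refine finrank_span_singleton fun h0 => ?_
    have hn0 : 0 < n := by
      rcases hn with h | h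
      · omega
      · exact h.2
    have := OddSymm.form_h_oneRow hm hn0 n
    rw [h0, map_zero, if_pos rfl] at this
    exact zero_ne_one this
  · refine OddSymm.primitives_inf_degreePart_eq_bot hΔ ?_
    rintro (rfl | ⟨he, h0⟩)
    · omega
    · rcases hn with rfl | ⟨ho, -⟩
      · omega
      · exact absurd he (Nat.not_even_iff_odd.2 ho)
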